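/- **Theorem.** Let $L$ be a (finitary) vocabulary with function and relation symbols, and let $K$ be a *universal class* of $L$-structures: $K$ is closed under isomorphisms, (nonempty) substructures and unions of nonempty $\subseteq$-chains. View $K$ as an abstract elementary class ordered by $\subseteq$ (so $M\le N$ means that $M$ is a substructure of $N$), with $\mathrm{LS}(K)=|L|+\aleph_0$. Let $\lambda\ge \mathrm{LS}(K)$. If $K$ has a type-full good $\lambda$-frame, then $K$ has a type-full good $(\ge\lambda)$-frame. **Definitions.** For $M\le N\in K$ and $a\in N$, the Galois type $\mathrm{gtp}(a/M;N)$ is the class of $(a,M,N)$ under the equivalence relation generated by atomic equivalence: $(a_1,M,N_1)$ and $(a_2,M,N_2)$ are atomically equivalent if there are $N\in K$ and embeddings $f_\ell:N_\ell\to N$ that agree on $M$ and satisfy $f_1(a_1)=f_2(a_2)$. $\mathrm{gS}(M)$ is the set of all Galois types over $M$, and $\mathrm{gS}^{na}(M)=\{\mathrm{gtp}(a/M;N): M\le N\in K,\ a\in N\setminus M\}$. Let $\mathcal F$ be an interval of cardinals with least element $\lambda$; $\mathcal F=\{\lambda\}$ for a $\lambda$-frame, and $\mathcal F$ consists of all cardinals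 $\ge\lambda$ for a $(\ge\lambda)$-frame. Let $K_{\mathcal F}=\{M\in K:|M|\in\mathcal F\}$. A *pre-$\mathcal F$-frame* on $K$ consists of sets $S^{bs}(M)\subseteq \mathrm{gS}^{na}(M)$ of basic types, for $M\in K_{\mathcal F}$, and of a relation $a\perp^N_{M_0}M_1$ between $M_0\le M_1\le N$ in $K_{\mathcal F}$ and $a\in N$, such that $K_\lambda\neq\emptyset$ and the following hold. * Invariance: the relation and the basic types are preserved by isomorphisms of $N$. * Monotonicity: if $a\perp^N_{M_0}M_1$ and $M_0\le M_0'\le M_1'\le M_1$, then $a\perp^{N}_{M_0'}M_1'$; and if $M_0\le M_1\le N'\le N$ and $a\in N'$, then $a\perp^{N'}_{M_0}M_1$ if and only if $a\perp^{N}_{M_0}M_1$ (all models in $K_{\mathcal F}$). * If $a\perp^N_M M$, then $\mathrm{gtp}(a/M;N)\in S^{bs}(M)$. A type $p\in\mathrm{gS}(M_1)$ *does not fork over* $M_0\le M_1$ if $a\perp^N_{M_0}M_1$ for some $a,N$ with $p=\mathrm{gtp}(a/M_1;N)$. The frame is *good* if, for all models in $K_{\mathcal F}$: 1. $K_{\mathcal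 F}$ has amalgamation, joint embedding and no maximal models. 2. Stability: $|S^{bs}(M)|\le|M|$. 3. Density: if $M<N$, there is $a\in N\setminus M$ with $\mathrm{gtp}(a/M;N)\in S^{bs}(M)$. 4. Existence: if $M\le N$, every $p\in S^{bs}(M)$ extends to some $q\in S^{bs}(N)$ that does not fork over $M$. 5. Uniqueness: if $p,q\in\mathrm{gS}(N)$ do not fork over $M\le N$ and $p\restriction M=q\restriction M$, then $p=q$. 6. Symmetry: if $a_1\perp^N_{M_0}M_2$, $a_2\in M_2$ and $\mathrm{gtp}(a_2/M_0;N)\in S^{bs}(M_0)$, then there are $N'\ge N$ and $M_1\le N'$ with $M_0\le M_1$, $a_1\in M_1$ and $a_2\perp^{N'}_{M_0}M_1$. 7. Local character: if $\delta$ is a limit ordinal, $(M_i)_{i\le\delta}$ is increasing and continuous and $p\in S^{bs}(M_\delta)$, then $p$ does not fork over $M_i$ for some $i<\delta$. 8. Continuity: if $\delta$ is a limit ordinal, $(M_i)_{i\le\delta}$ is increasing and continuous, $p\in\mathrm{gS}(M_\delta)$ and $p\restriction M_i$ does not fork over $M_0$ for every $i<\delta$, then $p\in S^{bs}(M_\delta)$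 and $p$ does not fork over $M_0$. 9. Transitivity: if $M_0\le M_1\le M_2$, $p\in\mathrm{gS}(M_2)$ does not fork over $M_1$ and $p\restriction M_1$ does not fork over $M_0$, then $p$ does not fork over $M_0$. The frame is *type-full* if $S^{bs}(M)=\mathrm{gS}^{na}(M)$ for all $M\in K_{\mathcal F}$. -/

import Mathlib

open FirstOrder FirstOrder.Language Cardinal

universe u

namespace UnivFrame

variable {L : FirstOrder.Language.{u, u}}

/-- A class of `L`-structures. The strong substructure relation on it is always `⊆`: `M ≤ N` means
that `M` is a substructure of `N` and both are in the class. -/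
abbrev StrClass (L : FirstOrder.Language.{u, u}) : Type (u + 1) :=
  (M : Type u) → [L.Structure M] → Prop

/-- `K` is a universal class: it is closed under isomorphisms, (nonempty) substructures and unions
of nonempty chains of substructures. -/
structure IsUniversalClass (K : StrClass L) : Prop where
  iso : ∀ (M N : Type u) [L.Structure M] [L.Structure N], (M ≃[L] N) → K M → K N
  substructure : ∀ (M : Type u) [L.Structure M] (S : L.Substructure M),
    K M → (S : Set M).Nonempty → K S
  chain : ∀ (N : Type u) [L.Structure N] (C : Set (L.Substructure N)),
    C.Nonempty → IsChain (· ≤ ·) C → (∀ S ∈ C, K S) → (⋃ S ∈ C, (S : Set N)) = Set.univ → K N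

/-- The Löwenheim-Skolem-Tarski number `|L| + ℵ₀` of a universal class of `L`-structures. -/
noncomputable def LS (L : FirstOrder.Language.{u, u}) : Cardinal.{u} := L.card + ℵ₀

/-- `K_F`: the members of `K` whose cardinality is in `F`. -/
def StrClass.restr (K : StrClass L) (F : Set Cardinal.{u}) : StrClass L :=
  fun M _ => K M ∧ #M ∈ F

/-- Amalgamation. -/
def Amalgamation (K : StrClass L) : Prop :=
  ∀ (M₀ M₁ M₂ : Type u) [L.Structure M₀] [L.Structure M₁] [L.Structure M₂],
    K M₀ → K M₁ → K M₂ → ∀ (f₁ : M₀ ↪[L] M₁) (f₂ : M₀ ↪[L] M₂),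
    ∃ (N : Type u) (_ : L.Structure N) (g₁ : M₁ ↪[L] N) (g₂ : M₂ ↪[L] N),
      K N ∧ g₁.comp f₁ = g₂.comp f₂

/-- Joint embedding. -/
def JointEmbedding (K : StrClass L) : Prop :=
  ∀ (M₁ M₂ : Type u) [L.Structure M₁] [L.Structure M₂], K M₁ → K M₂ →
    ∃ (N : Type u) (_ : L.Structure N), K N ∧ Nonempty (M₁ ↪[L] N) ∧ Nonempty (M₂ ↪[L] N)

/-- No maximal models: every member has a proper extension in the class. -/
def NoMaximalModels (K : StrClass L) : Prop :=
  ∀ (M : Type u) [L.Structure M], K M →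
    ∃ (N : Type u) (_ : L.Structure N) (f : M ↪[L] N), K N ∧ ¬ Function.Surjective f

/-! ### Galois types of length one -/

/-- A triple `(a, M, N)` with `M ≤ N ∈ K` (the inclusion being given as an embedding) and
`a ∈ N`. -/
structure Triple (K : StrClass L) (M : Type u) [L.Structure M] where
  N : Type u
  [str : L.Structure N]
  mem : K N
  emb : M ↪[L] N
  a : N

attribute [instance] Triple.str

/-- Atomic equivalence: the two triples can be mapped over `M` to a common extension in `K` so that
the two distinguished elements have the same image. -/
def Triple.AtEq {K : StrClass L} {M : Type u} [L.Structure M] (r s : Triple K M) : Prop :=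
  ∃ (N : Type u) (_ : L.Structure N) (f : r.N ↪[L] N) (g : s.N ↪[L] N),
    K N ∧ f.comp r.emb = g.comp s.emb ∧ f r.a = g s.a

/-- `gS(M)`: Galois types over `M` are the classes of triples for the equivalence relation generated
by atomic equivalence (its transitive closure). -/
def GaloisType (K : StrClass L) (M : Type u) [L.Structure M] : Type (u + 1) :=
  Quot (Triple.AtEq (K := K) (M := M))

/-- `gtp(a / M; N)` where `e : M → N` is the inclusion. -/
def gtp {K : StrClass L} {M N : Type u} [L.Structure M] [L.Structure N] (hN : K N)
    (e : M ↪[L] N) (a : N) : GaloisType K M :=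
  Quot.mk _ ⟨N, hN, e, a⟩

/-- The restriction of a Galois type over `M` to `M₀` along `e : M₀ → M`. -/
def GaloisType.restrict {K : StrClass L} {M₀ M : Type u} [L.Structure M₀] [L.Structure M]
    (p : GaloisType K M) (e : M₀ ↪[L] M) : GaloisType K M₀ :=
  Quot.map (fun r : Triple K M => (⟨r.N, r.mem, r.emb.comp e, r.a⟩ : Triple K M₀))
    (by
      rintro r s ⟨N, iN, f, g, hN, hfg, ha⟩
      refine ⟨N, iN, f, g, hN, ?_, ha⟩
      change f.comp (r.emb.comp e) = g.comp (s.emb.comp e)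
      rw [← Embedding.comp_assoc, hfg, Embedding.comp_assoc]) p

/-- `gS^na(M)`: the nonalgebraic types `gtp(a / M; N)`, where `a ∈ N \ M`. -/
def nonalgebraic (K : StrClass L) (M : Type u) [L.Structure M] : Set (GaloisType K M) :=
  {p | ∃ (N : Type u) (_ : L.Structure N) (hN : K N) (e : M ↪[L] N) (a : N),
    a ∉ Set.range e ∧ gtp hN e a = p}

/-! ### Frames -/

/-- A pre-`F`-frame on `(K, ⊆)`, where `F` is an interval of cardinals with a least element. `bs M`
is the set of basic types over `M`, and `nf M₀ M₁ a` (with `M₀`, `M₁`, `a` in `N`) is the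
nonforking relation between `a` and `M₁` over `M₀` in `N`. -/
structure PreFrame (K : StrClass L) (F : Set Cardinal.{u}) where
  bs : (M : Type u) → [L.Structure M] → Set (GaloisType K M)
  nf : {N : Type u} → [L.Structure N] → L.Substructure N → L.Substructure N → N → Prop
  /-- There is a model in the least cardinality of `F`. -/
  exists_model : ∃ (M : Type u) (_ : L.Structure M), K M ∧ IsLeast F #M
  bs_dom : ∀ (M : Type u) [L.Structure M] (p : GaloisType K M), p ∈ bs M →
    K.restr F M ∧ p ∈ nonalgebraic K M
  nf_dom : ∀ {N : Type u} [L.Structure N] {M₀ M₁ : L.Substructure N} {a : N}, nf M₀ M₁ a →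
    M₀ ≤ M₁ ∧ K.restr F M₀ ∧ K.restr F M₁ ∧ K.restr F N
  /-- Invariance of nonforking. -/
  nf_iso : ∀ {N N' : Type u} [L.Structure N] [L.Structure N'] (f : N ≃[L] N')
    {M₀ M₁ : L.Substructure N} {a : N}, nf M₀ M₁ a →
    K N' → nf (M₀.map f.toHom) (M₁.map f.toHom) (f a)
  /-- Invariance of basic types. -/
  bs_iso : ∀ {N N' : Type u} [L.Structure N] [L.Structure N'] (hN : K N) (hN' : K N')
    (f : N ≃[L] N') (M : L.Substructure N) (a : N), gtp hN M.subtype a ∈ bs M →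
    gtp hN' (M.map f.toHom).subtype (f a) ∈ bs (M.map f.toHom)
  /-- Monotonicity: increasing the base and decreasing the right-hand side. -/
  nf_mono : ∀ {N : Type u} [L.Structure N] {M₀ M₀' M₁' M₁ : L.Substructure N} {a : N},
    nf M₀ M₁ a → M₀ ≤ M₀' → M₀' ≤ M₁' → M₁' ≤ M₁ → K.restr F M₀' → K.restr F M₁' →
    nf M₀' M₁' a
  /-- Monotonicity: decreasing or increasing the ambient model. -/
  nf_ambient : ∀ {N : Type u} [L.Structure N] (N' : L.Substructure N)
    (M₀ M₁ : L.Substructure N') (a : N'), K.restr F N → K.restr F N' →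
    (nf M₀ M₁ a ↔ nf (M₀.map N'.subtype.toHom) (M₁.map N'.subtype.toHom) (a : N))
  /-- Nonforking types are basic. -/
  nf_basic : ∀ {N : Type u} [L.Structure N] (hN : K N) {M : L.Substructure N} {a : N},
    nf M M a → gtp hN M.subtype a ∈ bs M

/-- The type `p` over `M₁` does not fork over `M₀ ≤ M₁`: for some `a` and `N` with
`p = gtp(a / M₁; N)`, the element `a` is nonforking from `M₁` over `M₀` in `N`. -/
def PreFrame.DoesNotFork {K : StrClass L} {F : Set Cardinal.{u}} (s : PreFrame K F)
    {M₁ : Type u} [L.Structure M₁] (p : GaloisType K M₁) (M₀ : L.Substructure M₁) : Prop :=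
  ∃ (N : Type u) (_ : L.Structure N) (hN : K N) (e : M₁ ↪[L] N) (a : N),
    gtp hN e a = p ∧ s.nf (M₀.map e.toHom) e.toHom.range a

/-- `(M i)_{i < δ}` is an increasing continuous chain of members of `K` (substructures of `N`)
whose union is `N`, where `δ` is a limit ordinal. -/
structure IsResolution (K : StrClass L) (N : Type u) [L.Structure N] (δ : Ordinal.{u})
    (M : Ordinal.{u} → L.Substructure N) : Prop where
  isLimit : Order.IsSuccLimit δ
  mem : ∀ i < δ, K (M i)
  mono : ∀ i j, i ≤ j → j < δ → M i ≤ M j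
  continuous : ∀ j < δ, Order.IsSuccLimit j → (M j : Set N) = ⋃ i ∈ Set.Iio j, (M i : Set N)
  union : (⋃ i ∈ Set.Iio δ, (M i : Set N)) = Set.univ

/-- A good `F`-frame on `(K, ⊆)`. -/
structure GoodFrame (K : StrClass L) (F : Set Cardinal.{u}) extends PreFrame K F where
  amalgamation : Amalgamation (K.restr F)
  jointEmbedding : JointEmbedding (K.restr F)
  noMaximalModels : NoMaximalModels (K.restr F)
  stability : ∀ (M : Type u) [L.Structure M], K.restr F M →
    #(bs M) ≤ Cardinal.lift.{u + 1} #M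
  density : ∀ (N : Type u) [L.Structure N] (M : L.Substructure N) (hN : K N), K.restr F N →
    K.restr F M → M ≠ ⊤ → ∃ a : N, a ∉ M ∧ gtp hN M.subtype a ∈ bs M
  existence : ∀ (N : Type u) [L.Structure N] (M : L.Substructure N), K.restr F N →
    ∀ p ∈ bs M, ∃ q ∈ bs N, q.restrict M.subtype = p ∧ toPreFrame.DoesNotFork q M
  uniqueness : ∀ (N : Type u) [L.Structure N] (M : L.Substructure N) (p q : GaloisType K N),
    toPreFrame.DoesNotFork p M → toPreFrame.DoesNotFork q M →
    p.restrict M.subtype = q.restrict M.subtype → p = q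
  symmetry : ∀ (N : Type u) [L.Structure N] (hN : K N) (M₀ M₂ : L.Substructure N) (a₁ a₂ : N),
    nf M₀ M₂ a₁ → a₂ ∈ M₂ → gtp hN M₀.subtype a₂ ∈ bs M₀ →
    ∃ (N' : Type u) (_ : L.Structure N') (g : N ↪[L] N') (M₁ : L.Substructure N'),
      g a₁ ∈ M₁ ∧ nf (M₀.map g.toHom) M₁ (g a₂)
  localCharacter : ∀ (N : Type u) [L.Structure N] (δ : Ordinal.{u})
    (M : Ordinal.{u} → L.Substructure N), K.restr F N → IsResolution (K.restr F) N δ M →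
    ∀ p ∈ bs N, ∃ i < δ, toPreFrame.DoesNotFork p (M i)
  continuity : ∀ (N : Type u) [L.Structure N] (δ : Ordinal.{u})
    (M : Ordinal.{u} → L.Substructure N), K.restr F N → IsResolution (K.restr F) N δ M →
    ∀ p : GaloisType K N,
      (∀ i < δ, toPreFrame.DoesNotFork (p.restrict (M i).subtype)
        ((M 0).comap (M i).subtype.toHom)) →
      p ∈ bs N ∧ toPreFrame.DoesNotFork p (M 0)
  transitivity : ∀ (N : Type u) [L.Structure N] (M₁ : L.Substructure N) (M₀ : L.Substructure M₁)
    (p : GaloisType K N), toPreFrame.DoesNotFork p M₁ →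
    toPreFrame.DoesNotFork (p.restrict M₁.subtype) M₀ →
    toPreFrame.DoesNotFork p (M₀.map M₁.subtype.toHom)

/-- A frame is type-full if its basic types are exactly the nonalgebraic types. -/
def GoodFrame.TypeFull {K : StrClass L} {F : Set Cardinal.{u}} (s : GoodFrame K F) : Prop :=
  ∀ (M : Type u) [L.Structure M], K.restr F M → s.bs M = nonalgebraic K M

/-- `K` has a (type-full) good `F`-frame. -/
def HasGoodFrame (K : StrClass L) (F : Set Cardinal.{u}) : Prop :=
  ∃ s : GoodFrame K F, s.TypeFull

end UnivFrame

/-! In a universal class, the substructure generated by `M` and `a` inside `N` is itself in `K`, and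
its isomorphism type over `M` is the quantifier-free type of `a` over `M`. So Galois types are
quantifier-free types (`gtp_eq_iff`). Two consequences drive the proof. Types are determined by
their restrictions to small submodels, and a coherent directed family of types can be glued to a
type realized in `K` (`exists_glue`), because membership in `K` depends only on finitely generated
substructures.

Nonforking of `a` from a large `M` over a small `A` means nonforking from every `B` of size `lam`
between `A` and `M`; over a large base it means nonforking over some small `A` inside the base.
Uniqueness follows from locality, transitivity by comparing small submodels (`indepOver_trans`). For
existence, a type over `A` has its unique nonforking extension to each small `B`; uniqueness makes
these coherent, so they glue (`exists_indepOver_extension`). Local character for long chains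
intersects the chain with one small model over which the type does not fork: intersections of models
are again models (`exists_indepOver_of_chain`). Symmetry reduces to `lam` because each element of
the model generated by `a` and `M₀` is a term in `a` and finitely many elements of `M₀`. Continuity
follows from local character and transitivity.

Amalgamation above `lam` is not assumed. Extending types along embeddings adds one point at a time
to a partial amalgam, and Zorn's lemma finishes. Stability is an induction on the size of the model,
since each type is determined by its restriction to some member of a filtration by smaller models.
-/

namespace UnivFrame

variable {L : FirstOrder.Language.{u, u}}

/-! ### Quantifier-free types -/

/-- The families `v` and `w` have the same quantifier-free type. -/
def QfEq (L : FirstOrder.Language.{u, u}) {X A B : Type u} [L.Structure A] [L.Structure B]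
    (v : X → A) (w : X → B) : Prop :=
  (∀ t s : L.Term X, t.realize v = s.realize v ↔ t.realize w = s.realize w) ∧
    ∀ (n : ℕ) (R : L.Relations n) (ts : Fin n → L.Term X),
      Structure.RelMap R (fun i => (ts i).realize v) ↔
        Structure.RelMap R (fun i => (ts i).realize w)

/-- The restrictions of the families `v` and `w` to `D` have the same quantifier-free type. -/
def QfEqOn (L : FirstOrder.Language.{u, u}) {X A B : Type u} [L.Structure A] [L.Structure B]
    (D : Set X) (v : X → A) (w : X → B) : Prop :=
  QfEq L (fun x : D => v x) (fun x : D => w x)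

section QfEq

variable {X Y A B C : Type u} [L.Structure A] [L.Structure B] [L.Structure C]
  {u : X → A} {v : X → B} {w : X → C}

theorem QfEq.refl (v : X → A) : QfEq L v v :=
  ⟨fun _ _ => Iff.rfl, fun _ _ _ => Iff.rfl⟩

theorem QfEq.symm (h : QfEq L u v) : QfEq L v u :=
  ⟨fun t s => (h.1 t s).symm, fun n R ts => (h.2 n R ts).symm⟩

theorem QfEq.trans (h : QfEq L u v) (h' : QfEq L v w) : QfEq L u w :=
  ⟨fun t s => (h.1 t s).trans (h'.1 t s), fun n R ts => (h.2 n R ts).trans (h'.2 n R ts)⟩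

theorem QfEq.comp (h : QfEq L u v) (g : Y → X) : QfEq L (u ∘ g) (v ∘ g) := by
  refine ⟨fun t s => ?_, fun n R ts => ?_⟩
  · simpa using h.1 (t.relabel g) (s.relabel g)
  · simpa using h.2 n R fun i => (ts i).relabel g

theorem QfEq.embedding (f : B ↪[L] C) (v : X → B) : QfEq L v (f ∘ v) := by
  refine ⟨fun t s => ?_, fun n R ts => ?_⟩
  · simp only [HomClass.realize_term, f.injective.eq_iff]
  · simp only [HomClass.realize_term]
    exact (f.map_rel R _).symm

theorem QfEq.apply_eq_iff (h : QfEq L u v) (x y : X) : u x = u y ↔ v x = v y :=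
  h.1 (Term.var x) (Term.var y)

theorem QfEqOn.mono {D D' : Set X} (h : QfEqOn L D u v) (hD : D' ⊆ D) : QfEqOn L D' u v :=
  QfEq.comp h (Set.inclusion hD)

theorem QfEqOn.symm {D : Set X} (h : QfEqOn L D u v) : QfEqOn L D v u :=
  QfEq.symm h

theorem QfEqOn.trans {D : Set X} (h : QfEqOn L D u v) (h' : QfEqOn L D v w) : QfEqOn L D u w :=
  QfEq.trans h h'

theorem QfEqOn.apply_eq_iff {D : Set X} (h : QfEqOn L D u v) {x y : X} (hx : x ∈ D)
    (hy : y ∈ D) : u x = u y ↔ v x = v y :=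
  QfEq.apply_eq_iff h ⟨x, hx⟩ ⟨y, hy⟩

theorem mem_closure_range_iff {x : B} :
    x ∈ Substructure.closure L (Set.range v) ↔ ∃ t : L.Term X, t.realize v = x := by
  constructor
  · intro h
    obtain ⟨t, rfl⟩ := Substructure.mem_closure_iff_exists_term.1 h
    refine ⟨t.relabel fun y => y.2.choose, ?_⟩
    rw [Term.realize_relabel]
    congr 1
    funext y
    exact y.2.choose_spec
  · rintro ⟨t, rfl⟩
    exact t.realize_mem _ fun a => Substructure.subset_closure ⟨a, rfl⟩

/-- A generating family can be mapped to any family of the same quantifier-free type. -/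
theorem QfEq.exists_embedding (h : QfEq L v w)
    (hv : Substructure.closure L (Set.range v) = ⊤) : ∃ f : B ↪[L] C, ∀ x, f (v x) = w x := by
  have hex : ∀ b : B, ∃ t : L.Term X, t.realize v = b := fun b =>
    mem_closure_range_iff.1 (hv ▸ Substructure.mem_top b)
  choose t ht using hex
  -- Terms with equal values under `v` have equal values under `w`, so the map does not depend on
  -- the chosen terms.
  have key : ∀ s : L.Term X, (t (s.realize v)).realize w = s.realize w := fun s =>
    (h.1 _ _).1 (ht _)
  refine ⟨⟨⟨fun b => (t b).realize w, fun b c hbc => ?_⟩, ?_, ?_⟩, fun x => key (Term.var x)⟩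
  · simpa [ht] using (h.1 _ _).2 hbc
  · intro n F xs
    have := key (Term.func F fun i => t (xs i))
    simpa [ht, Term.realize_func, Function.comp_def] using this
  · intro n R xs
    have := h.2 n R fun i => t (xs i)
    simpa [ht, Function.comp_def] using this.symm

/-- `S` is kept separate from `Set.range v` so that the domain can be the closure of a set written
differently, such as `insert b A`. -/
theorem QfEq.exists_embedding_closure {S : Set B} (h : QfEq L v w) (hS : S = Set.range v) :
    ∃ f : Substructure.closure L S ↪[L] C,
      ∀ x (hx : v x ∈ Substructure.closure L S), f ⟨v x, hx⟩ = w x := by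
  subst hS
  have hm : ∀ x, v x ∈ Substructure.closure L (Set.range v) := fun x =>
    Substructure.subset_closure ⟨x, rfl⟩
  let v' : X → Substructure.closure L (Set.range v) := fun x => ⟨v x, hm x⟩
  have h1 : QfEq L v' v := QfEq.embedding (Substructure.subtype _) v'
  have h2 : Substructure.closure L (Set.range v') = ⊤ := by
    apply Substructure.map_injective_of_injective
      (f := (Substructure.subtype (Substructure.closure L (Set.range v))).toHom)
      (Substructure.subtype_injective _)
    rw [← Hom.range_eq_map, Substructure.range_subtype, Substructure.map_closure, ← Set.range_comp]
    rfl
  obtain ⟨f, hf⟩ := (h1.trans h).exists_embedding h2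
  exact ⟨f, fun x _ => hf x⟩

theorem QfEq.exists_embedding_of_id {w : A → C} (h : QfEq L (id : A → A) w) :
    ∃ f : A ↪[L] C, ∀ x, f x = w x :=
  h.exists_embedding (by simp)

open Classical in
/-- Equality of quantifier-free types is local. -/
theorem QfEq.of_finite (h : ∀ s : Finset X, ∃ D : Set X, (s : Set X) ⊆ D ∧ QfEqOn L D u v) :
    QfEq L u v := by
  refine ⟨fun t s => ?_, fun n R ts => ?_⟩
  · obtain ⟨D, hD, h⟩ := h (t.varFinset ∪ s.varFinset)
    have ht : (t.varFinset : Set X) ⊆ D := fun x hx => hD (by simp_all)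
    have hs : (s.varFinset : Set X) ⊆ D := fun x hx => hD (by simp_all)
    have := h.1 (t.restrictVar (Set.inclusion ht)) (s.restrictVar (Set.inclusion hs))
    rwa [Term.realize_restrictVar (v := fun x : D => u x) u (fun _ => rfl),
      Term.realize_restrictVar (v := fun x : D => u x) u (fun _ => rfl),
      Term.realize_restrictVar (v := fun x : D => v x) v (fun _ => rfl),
      Term.realize_restrictVar (v := fun x : D => v x) v (fun _ => rfl)] at this
  · obtain ⟨D, hD, h⟩ := h (Finset.univ.biUnion fun i => (ts i).varFinset)
    have ht : ∀ i, ((ts i).varFinset : Set X) ⊆ D := fun i x hx =>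
      hD (by simpa using ⟨i, hx⟩)
    have := h.2 n R fun i => (ts i).restrictVar (Set.inclusion (ht i))
    have hu : ∀ i, ((ts i).restrictVar (Set.inclusion (ht i))).realize (fun x : D => u x) =
        (ts i).realize u := fun i => Term.realize_restrictVar u (fun _ => rfl)
    have hv : ∀ i, ((ts i).restrictVar (Set.inclusion (ht i))).realize (fun x : D => v x) =
        (ts i).realize v := fun i => Term.realize_restrictVar v (fun _ => rfl)
    simpa only [hu, hv] using this

theorem QfEqOn.of_finite {D : Set X} (h : ∀ s : Set X, s.Finite → s ⊆ D →
    ∃ D' : Set X, s ⊆ D' ∧ QfEqOn L D' u v) : QfEqOn L D u v := by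
  refine QfEq.of_finite fun s => ?_
  obtain ⟨D', hD', h'⟩ := h (Subtype.val '' (s : Set D)) (s.finite_toSet.image _)
    (Subtype.coe_image_subset _ _)
  exact ⟨Subtype.val ⁻¹' D', fun x hx => hD' ⟨x, hx, rfl⟩,
    h'.comp fun x : (Subtype.val ⁻¹' D' : Set D) => (⟨x.1, x.2⟩ : D')⟩

end QfEq

/-! ### Cardinality of generated substructures, and well-ordered enumerations -/

theorem aleph0_le_LS : ℵ₀ ≤ LS L := self_le_add_left _ _

theorem card_closure_le {M : Type u} [L.Structure M] {s : Set M} {κ : Cardinal.{u}}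
    (hκ : LS L ≤ κ) (hs : #s ≤ κ) : #(Substructure.closure L s) ≤ κ := by
  have h := Substructure.lift_card_closure_le (L := L) (s := s)
  simp only [Cardinal.lift_id] at h
  have h0 : ℵ₀ ≤ κ := aleph0_le_LS.trans hκ
  refine h.trans (max_le h0 (add_le_of_le h0 hs ?_))
  refine le_trans ?_ hκ
  refine le_trans ?_ (self_le_add_right _ _)
  rw [Language.card_eq_card_functions_add_card_relations]
  refine le_trans (le_of_eq ?_) (self_le_add_right _ _)
  rw [mk_sigma]
  congr 1
  funext i
  simp

/-- A well-ordering of least possible order type: its proper initial segments are smaller than `X`.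
It provides the filtrations for the inductions on cardinality. -/
theorem exists_rank (X : Type u) : ∃ rank : X → Ordinal.{u}, Function.Injective rank ∧
    (∀ i < (#X).ord, ∃ x, rank x = i) ∧ (∀ x, rank x < (#X).ord) ∧
    ∀ i < (#X).ord, #{x | rank x < i} < #X := by
  obtain ⟨r, wo, hr⟩ := exists_ord_eq X
  refine ⟨Ordinal.typein r, Ordinal.typein_injective r, fun i hi => ?_, fun x => ?_,
    fun i hi => ?_⟩
  · exact Ordinal.typein_surj r (hr ▸ hi)
  · rw [hr]; exact Ordinal.typein_lt_type r x
  · obtain ⟨x, rfl⟩ := Ordinal.typein_surj r (hr ▸ hi)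
    have := card_typein_lt x hr
    rw [Ordinal.card_typein] at this
    convert this using 3
    ext y
    exact Ordinal.typein_lt_typein r

/-! ### Closure properties of universal classes -/

section Universal

variable {K : StrClass L}

theorem IsUniversalClass.of_embedding (hK : IsUniversalClass K) {A B : Type u} [L.Structure A]
    [L.Structure B] [Nonempty A] (f : A ↪[L] B) (hB : K B) : K A := by
  refine hK.iso _ _ f.equivRange.symm (hK.substructure _ _ hB ?_)
  obtain ⟨a⟩ := ‹Nonempty A›
  exact ⟨f a, a, rfl⟩

theorem map_comap_subtype {N : Type u} [L.Structure N] {S T : L.Substructure N} (h : T ≤ S) :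
    (T.comap S.subtype.toHom).map S.subtype.toHom = T := by
  ext x
  simp only [Substructure.mem_map, Substructure.mem_comap]
  constructor
  · rintro ⟨y, hy, rfl⟩; exact hy
  · exact fun hx => ⟨⟨x, h hx⟩, hx, rfl⟩

theorem IsUniversalClass.map_iff (hK : IsUniversalClass K) {N N' : Type u} [L.Structure N]
    [L.Structure N'] (f : N ↪[L] N') (T : L.Substructure N) : K (T.map f.toHom) ↔ K T :=
  ⟨hK.iso _ _ (f.substructureEquivMap T).symm, hK.iso _ _ (f.substructureEquivMap T)⟩

theorem IsUniversalClass.sUnion_chain (hK : IsUniversalClass K) {N : Type u} [L.Structure N]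
    (S : L.Substructure N) (C : Set (L.Substructure N)) (hne : C.Nonempty)
    (hC : IsChain (· ≤ ·) C) (hCK : ∀ T ∈ C, K T) (hle : ∀ T ∈ C, T ≤ S)
    (hS : ∀ x ∈ S, ∃ T ∈ C, x ∈ T) : K S := by
  refine hK.chain S ((fun T => T.comap S.subtype.toHom) '' C) (hne.image _) ?_ ?_ ?_
  · rintro _ ⟨T, hT, rfl⟩ _ ⟨T', hT', rfl⟩ _
    exact (hC.total hT hT').imp (fun h => Substructure.monotone_comap h)
      (fun h => Substructure.monotone_comap h)
  · rintro _ ⟨T, hT, rfl⟩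
    rw [← hK.map_iff S.subtype, map_comap_subtype (hle T hT)]
    exact hCK T hT
  · refine Set.eq_univ_of_forall fun x => ?_
    obtain ⟨T, hT, hx⟩ := hS x x.2
    simp only [Set.mem_iUnion]
    exact ⟨_, ⟨T, hT, rfl⟩, hx⟩

/-- Membership in a universal class only depends on the finitely generated substructures. -/
theorem IsUniversalClass.closure_mem (hK : IsUniversalClass K) {N : Type u} [L.Structure N]
    (hfin : ∀ A : Set N, A.Finite → A.Nonempty → K (Substructure.closure L A)) (A : Set N)
    (hA : A.Nonempty) : K (Substructure.closure L A) := by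
  induction hκ : #A using WellFoundedLT.induction generalizing A with
  | ind κ ih =>
    by_cases hf : A.Finite
    · exact hfin A hf hA
    have hinf : ℵ₀ ≤ #A := by
      rw [← Cardinal.infinite_iff]; exact Set.infinite_coe_iff.2 hf
    obtain ⟨rank, hinj, hsurj, hlt, hcard⟩ := exists_rank A
    have hlim := isSuccLimit_ord hinf
    let T : Ordinal.{u} → Set N := fun i => Subtype.val '' {x : A | rank x < i}
    have hTmono : Monotone T := fun i j hij =>
      Set.image_mono fun x (hx : rank x < i) => lt_of_lt_of_le hx hij
    -- An infinite generating set is the union of its smaller initial segments. The index `0` is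
    -- left out because `T 0` is empty and only nonempty sets are covered by the induction
    -- hypothesis.
    refine hK.sUnion_chain _
      ((fun i => Substructure.closure L (T i)) '' {i | 0 < i ∧ i < (#A).ord}) ?_ ?_ ?_ ?_ ?_
    · exact ⟨_, Order.succ 0, ⟨Order.lt_succ 0, hlim.succ_lt hlim.bot_lt⟩, rfl⟩
    · rintro _ ⟨i, -, rfl⟩ _ ⟨j, -, rfl⟩ _
      exact (le_total i j).imp (fun h => Substructure.closure_mono (hTmono h))
        (fun h => Substructure.closure_mono (hTmono h))
    · rintro _ ⟨i, ⟨hi0, hi⟩, rfl⟩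
      refine ih #(T i) ?_ _ ?_ rfl
      · rw [← hκ]
        exact lt_of_le_of_lt mk_image_le (hcard i hi)
      · obtain ⟨x, hx⟩ := hsurj 0 (hi0.trans hi)
        exact ⟨x, x, by simpa [hx] using hi0, rfl⟩
    · rintro _ ⟨i, -, rfl⟩
      exact Substructure.closure_mono (Subtype.coe_image_subset _ _)
    · intro x hx
      have hA' : A = ⋃ i : Set.Ioo 0 (#A).ord, T i := by
        ext y
        simp only [Set.mem_iUnion]
        refine ⟨fun hy => ⟨⟨Order.succ (rank ⟨y, hy⟩), ?_, hlim.succ_lt (hlt _)⟩, ⟨y, hy⟩,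
          Order.lt_succ (rank ⟨y, hy⟩), rfl⟩, ?_⟩
        · exact lt_of_le_of_lt zero_le (Order.lt_succ _)
        · rintro ⟨i, z, -, rfl⟩; exact z.2
      rw [hA', Substructure.closure_iUnion] at hx
      have : Nonempty (Set.Ioo 0 (#A).ord) :=
        ⟨⟨Order.succ 0, Order.lt_succ 0, hlim.succ_lt hlim.bot_lt⟩⟩
      rw [Substructure.mem_iSup_of_directed] at hx
      · obtain ⟨i, hi⟩ := hx
        exact ⟨_, ⟨i, i.2, rfl⟩, hi⟩
      · exact Monotone.directed_le fun i j hij => Substructure.closure_mono (hTmono hij)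

/-- A universal class is closed under directed unions. -/
theorem IsUniversalClass.directed_union (hK : IsUniversalClass K) {N : Type u} [L.Structure N]
    [Nonempty N] {ι : Type*} (S : ι → L.Substructure N)
    (hS : ∀ A : Set N, A.Finite → ∃ i, A ⊆ S i) (hSK : ∀ i, K (S i)) : K N := by
  -- A finite set lies in some `S i`, so what it generates is a substructure of a member of `K`.
  have h := hK.closure_mem (N := N) (fun A hA hne => by
    obtain ⟨i, hi⟩ := hS A hA
    obtain ⟨a, ha⟩ := hne
    have : Nonempty (Substructure.closure L A) := ⟨⟨a, Substructure.subset_closure ha⟩⟩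
    exact hK.of_embedding (Substructure.inclusion (Substructure.closure_le.2 hi)) (hSK i))
    Set.univ Set.univ_nonempty
  rw [Substructure.closure_univ] at h
  exact hK.iso _ _ Substructure.topEquiv h

end Universal

/-! ### Gluing coherent families of quantifier-free types. -/

variable {K : StrClass L}

theorem closure_range_codRestrict {X A : Type u} [L.Structure A] (v : X → A) :
    Substructure.closure L (Set.range fun x =>
      (⟨v x, Substructure.subset_closure ⟨x, rfl⟩⟩ : Substructure.closure L (Set.range v))) =
      ⊤ := by
  apply Substructure.map_injective_of_injective
    (f := (Substructure.subtype (Substructure.closure L (Set.range v))).toHom)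
    (Substructure.subtype_injective _)
  rw [← Hom.range_eq_map, Substructure.range_subtype, Substructure.map_closure, ← Set.range_comp]
  rfl

/-- A coherent directed family of quantifier-free types realized in `K` is realized in `K`. -/
theorem IsUniversalClass.exists_glue (hK : IsUniversalClass K) {X ι : Type u} [Preorder ι]
    [IsDirectedOrder ι] [Nonempty ι] (D : ι → Set X) (hD : Monotone D)
    (hne : ∀ i, (D i).Nonempty) (B : ι → Type u) [∀ i, L.Structure (B i)] (v : ∀ i, X → B i)
    (hB : ∀ i, K (B i)) (hv : ∀ i j, i ≤ j → QfEqOn L (D i) (v i) (v j)) :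
    ∃ (N : Type u) (_ : L.Structure N) (w : X → N), K N ∧ ∀ i, QfEqOn L (D i) (v i) w := by
  -- There need not be maps between the `B i` themselves; between the parts generated by the
  -- families there are, and they are determined on generators. This makes the system functorial.
  let G : ι → Type u := fun i => Substructure.closure L (Set.range fun x : D i => v i x)
  let g : ∀ i, D i → G i := fun i x => ⟨v i x, Substructure.subset_closure ⟨x, rfl⟩⟩
  have hgv : ∀ i, QfEq L (g i) (fun x : D i => v i x) := fun i =>
    QfEq.embedding (Substructure.subtype _) (g i)
  have hgen : ∀ i, Substructure.closure L (Set.range (g i)) = ⊤ := fun i =>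
    closure_range_codRestrict _
  have hex : ∀ i j (h : i ≤ j), ∃ f : G i ↪[L] G j,
      ∀ x, f (g i x) = g j (Set.inclusion (hD h) x) := fun i j h =>
    (((hgv i).trans (hv i j h)).trans
      ((hgv j).symm.comp (Set.inclusion (hD h)))).exists_embedding (hgen i)
  choose f hf using hex
  have hsys : DirectedSystem G fun i j h => f i j h := by
    refine ⟨fun i x => ?_, fun k j i hij hjk x => ?_⟩
    · have : (f i i le_rfl).toHom = (Embedding.refl L (G i)).toHom := by
        refine Hom.eq_of_eqOn_dense (hgen i) ?_
        rintro _ ⟨x, rfl⟩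
        exact hf i i le_rfl x
      exact congrArg (fun h : G i →[L] G i => h x) this
    · have : ((f j k hjk).comp (f i j hij)).toHom = (f i k (hij.trans hjk)).toHom := by
        refine Hom.eq_of_eqOn_dense (hgen i) ?_
        rintro _ ⟨x, rfl⟩
        change f j k hjk (f i j hij (g i x)) = f i k _ (g i x)
        rw [hf, hf, hf]
      exact congrArg (fun h : G i →[L] G k => h x) this
  let of := DirectLimit.of L ι G f
  have hof : ∀ i j (hij : i ≤ j) (x : D i), of j (g j (Set.inclusion (hD hij) x)) =
      of i (g i x) := fun i j hij x => by
    rw [← hf i j hij]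
    exact DirectLimit.of_f
  obtain ⟨i₀⟩ := ‹Nonempty ι›
  have : Nonempty ι := ⟨i₀⟩
  obtain ⟨x₀, hx₀⟩ := hne i₀
  have : Nonempty (Language.DirectLimit G f) := ⟨of i₀ (g i₀ ⟨x₀, hx₀⟩)⟩
  classical
  let w : X → Language.DirectLimit G f := fun x =>
    if h : ∃ i, x ∈ D i then of h.choose (g h.choose ⟨x, h.choose_spec⟩) else Classical.arbitrary _
  have hw : ∀ i (x : D i), w x = of i (g i x) := fun i x => by
    have h : ∃ i, (x : X) ∈ D i := ⟨i, x.2⟩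
    obtain ⟨k, hik, hjk⟩ := exists_ge_ge i h.choose
    simp only [w, dif_pos h]
    rw [← hof i k hik x, ← hof h.choose k hjk ⟨x, h.choose_spec⟩]
  refine ⟨Language.DirectLimit G f, inferInstance, w, ?_, fun i => ?_⟩
  · refine hK.directed_union (fun i => (of i).toHom.range) (fun A hA => ?_) fun i => ?_
    · obtain ⟨i, y, hy⟩ := @DirectLimit.exists_quotient_mk'_sigma_mk'_eq L ι _ G _ f _ _ _ A
        hA.to_subtype Subtype.val
      exact ⟨i, fun a ha => ⟨y ⟨a, ha⟩, (congrFun hy ⟨a, ha⟩).symm⟩⟩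
    · obtain ⟨x, hx⟩ := hne i
      have : Nonempty (G i) := ⟨g i ⟨x, hx⟩⟩
      exact hK.iso _ _ (of i).equivRange (hK.of_embedding (Substructure.subtype _) (hB i))
  · have : (fun x : D i => w x) = of i ∘ g i := funext (hw i)
    unfold QfEqOn
    rw [this]
    exact (hgv i).symm.trans (QfEq.embedding _ _)

/-! ### Galois types are quantifier-free types -/

/-- The family consisting of the embedded model and one additional point. -/
def pt {M N : Type u} (e : M → N) (a : N) : Option M → N := fun o => o.elim a e

theorem notMem_range_of_qfEq {M N N' : Type u} [L.Structure N] [L.Structure N']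
    {e : M → N} {e' : M → N'} {a : N} {a' : N'} (h : QfEq L (pt e a) (pt e' a'))
    (ha : a ∉ Set.range e) : a' ∉ Set.range e' := by
  rintro ⟨m, hm⟩
  exact ha ⟨m, (h.apply_eq_iff (some m) none).2 hm⟩

theorem qfEqOn_pt_iff {M N N' : Type u} [L.Structure N] [L.Structure N']
    {e : M → N} {e' : M → N'} {a : N} {a' : N'} (B : Set M) :
    QfEqOn L ({none} ∪ some '' B) (pt e a) (pt e' a') ↔
      QfEq L (pt (fun x : B => e x) a) (pt (fun x : B => e' x) a') := by
  constructor
  · intro h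
    have := h.comp fun o : Option B => (⟨o.map Subtype.val, by
      cases o with
      | none => exact Or.inl rfl
      | some x => exact Or.inr ⟨x, x.2, rfl⟩⟩ : ({none} ∪ some '' B : Set (Option M)))
    have hcomp : ∀ {Q : Type u} (k : M → Q) (c : Q),
        (pt (fun x : B => k x) c) = fun o : Option B => pt k c (o.map Subtype.val) := by
      intro Q k c
      funext o
      cases o <;> rfl
    rw [hcomp, hcomp]
    exact this
  · intro h
    have hex : ∀ o : ({none} ∪ some '' B : Set (Option M)),
        ∃ o' : Option B, o'.map Subtype.val = o.1 := by
      rintro ⟨_, rfl | ⟨x, hx, rfl⟩⟩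
      exacts [⟨none, rfl⟩, ⟨some ⟨x, hx⟩, rfl⟩]
    choose g hg using hex
    have hcomp : ∀ {Q : Type u} (k : M → Q) (c : Q), (pt (fun x : B => k x) c) ∘ g =
        fun o : ({none} ∪ some '' B : Set (Option M)) => pt k c o := by
      intro Q k c
      funext o
      rw [← hg o]
      simp only [Function.comp]
      cases g o <;> rfl
    have := h.comp g
    rw [hcomp, hcomp] at this
    exact this

section Types

variable {M N N' : Type u} [L.Structure M] [L.Structure N] [L.Structure N']

theorem gtp_embedding {hN : K N} {hN' : K N'} (f : N ↪[L] N') (e : M ↪[L] N) (a : N) :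
    gtp hN e a = gtp hN' (f.comp e) (f a) :=
  Quot.sound ⟨N', inferInstance, f, Embedding.refl L N', hN', rfl, rfl⟩

theorem comp_pt (f : N → N') (e : M → N) (a : N) : f ∘ pt e a = pt (f ∘ e) (f a) := by
  funext o; cases o <;> rfl

/-- `C` is generated by the image of `M` and the point inside `N`. It belongs to `K` by closure
under substructures, and it maps to `N'` because the quantifier-free types agree. -/
theorem exists_common_of_qfEq (hK : IsUniversalClass K) (hN : K N) {e : M ↪[L] N}
    {e' : M ↪[L] N'} {a : N} {a' : N'} (h : QfEq L (pt e a) (pt e' a')) :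
    ∃ (C : Type u) (_ : L.Structure C) (_ : K C) (i : M ↪[L] C) (c : C) (f : C ↪[L] N)
      (f' : C ↪[L] N'), f.comp i = e ∧ f c = a ∧ f'.comp i = e' ∧ f' c = a' ∧
      Substructure.closure L (insert c (Set.range i)) = ⊤ := by
  let S := Substructure.closure L (Set.range (pt e a))
  let w : Option M → S := fun o => ⟨pt e a o, Substructure.subset_closure ⟨o, rfl⟩⟩
  have hgen : Substructure.closure L (Set.range w) = ⊤ := closure_range_codRestrict _
  obtain ⟨f', hf'⟩ :=
    ((QfEq.embedding (Substructure.subtype S) w).trans h).exists_embedding hgen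
  have : Nonempty S := ⟨w none⟩
  refine ⟨S, inferInstance, hK.of_embedding (Substructure.subtype _) hN,
    e.codRestrict S fun m => (w (some m)).2, w none, S.subtype, f', ?_, rfl, ?_, hf' none, ?_⟩
  · ext m; rfl
  · ext m; exact hf' (some m)
  · rw [← hgen]
    congr 1
    ext x
    constructor
    · rintro (rfl | ⟨m, rfl⟩)
      exacts [⟨none, rfl⟩, ⟨some m, rfl⟩]
    · rintro ⟨_ | m, rfl⟩
      exacts [Or.inl rfl, Or.inr ⟨m, rfl⟩]

/-- Embeddings preserve quantifier-free types, hence so does the equivalence relation that atomic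
equivalence generates. Conversely both triples extend the same generated triple, so no amalgamation
is needed. -/
theorem gtp_eq_iff (hK : IsUniversalClass K) {hN : K N} {hN' : K N'} {e : M ↪[L] N}
    {e' : M ↪[L] N'} {a : N} {a' : N'} :
    gtp hN e a = gtp hN' e' a' ↔ QfEq L (pt e a) (pt e' a') := by
  constructor
  · intro h
    have h1 : Relation.EqvGen Triple.AtEq (⟨N, hN, e, a⟩ : Triple K M) ⟨N', hN', e', a'⟩ :=
      Quot.eqvGen_exact h
    have key : ∀ r s : Triple K M, Relation.EqvGen Triple.AtEq r s →
        QfEq L (pt r.emb r.a) (pt s.emb s.a) := by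
      intro r s hrs
      induction hrs with
      | rel r s hrs =>
        obtain ⟨P, _, f, g, -, hfg, ha⟩ := hrs
        have h2 : f ∘ pt r.emb r.a = g ∘ pt s.emb s.a := by
          rw [comp_pt, comp_pt, ha]
          congr 1
          exact congrArg DFunLike.coe hfg
        exact (QfEq.embedding f _).trans (h2 ▸ (QfEq.embedding g _).symm)
      | refl r => exact QfEq.refl _
      | symm r s _ ih => exact ih.symm
      | trans r s t _ _ ih ih' => exact ih.trans ih'
    exact key _ _ h1
  · intro h
    obtain ⟨C, _, hC, i, c, f, f', rfl, rfl, rfl, rfl, -⟩ := exists_common_of_qfEq hK hN h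
    rw [← gtp_embedding (hN := hC) f i c, gtp_embedding (hN' := hN') f' i c]

theorem exists_eq_gtp (p : GaloisType K M) :
    ∃ (N : Type u) (_ : L.Structure N) (hN : K N) (e : M ↪[L] N) (a : N), gtp hN e a = p := by
  induction p using Quot.ind with
  | mk r => exact ⟨r.N, r.str, r.mem, r.emb, r.a, rfl⟩

theorem gtp_mem_nonalgebraic_iff (hK : IsUniversalClass K) {hN : K N} {e : M ↪[L] N} {a : N} :
    gtp hN e a ∈ nonalgebraic K M ↔ a ∉ Set.range e := by
  constructor
  · rintro ⟨N', _, hN', e', a', ha', h⟩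
    exact notMem_range_of_qfEq ((gtp_eq_iff hK).1 h) ha'
  · exact fun ha => ⟨N, inferInstance, hN, e, a, ha, rfl⟩

theorem restrict_gtp {M₀ : Type u} [L.Structure M₀] {hN : K N} {e : M ↪[L] N} {a : N}
    (i : M₀ ↪[L] M) : (gtp hN e a).restrict i = gtp hN (e.comp i) a := rfl

end Types

/-! ### Images of substructures under embeddings -/

section Maps

variable {N N' P : Type u} [L.Structure N] [L.Structure N'] [L.Structure P]

theorem map_map_embedding (f : N ↪[L] N') (g : N' ↪[L] P) (S : L.Substructure N) :
    (S.map f.toHom).map g.toHom = S.map (g.comp f).toHom :=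
  Substructure.map_map _ _ _

theorem map_embedding_injective (f : N ↪[L] N') :
    Function.Injective (Substructure.map (L := L) f.toHom) :=
  Substructure.map_injective_of_injective (f := f.toHom) f.injective

theorem map_embedding_le_iff (f : N ↪[L] N') {S T : L.Substructure N} :
    S.map f.toHom ≤ T.map f.toHom ↔ S ≤ T :=
  Substructure.map_le_map_iff_of_injective (f := f.toHom) f.injective

theorem map_comap_of_le_range (f : N ↪[L] N') {T : L.Substructure N'} (h : T ≤ f.toHom.range) :
    (T.comap f.toHom).map f.toHom = T := by
  ext x
  simp only [Substructure.mem_map, Substructure.mem_comap]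
  constructor
  · rintro ⟨y, hy, rfl⟩; exact hy
  · intro hx
    obtain ⟨y, rfl⟩ := h hx
    exact ⟨y, hx, rfl⟩

theorem map_range (f : N ↪[L] N') (g : N' ↪[L] P) :
    f.toHom.range.map g.toHom = (g.comp f).toHom.range :=
  (Hom.range_comp _ _).symm

theorem card_map_embedding (f : N ↪[L] N') (S : L.Substructure N) : #(S.map f.toHom) = #S :=
  (mk_congr (f.substructureEquivMap S).toEquiv).symm

theorem card_range_embedding (f : N ↪[L] N') : #f.toHom.range = #N :=
  (mk_congr f.equivRange.toEquiv).symm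

theorem card_mono {S T : L.Substructure N} (h : S ≤ T) : #S ≤ #T :=
  mk_le_mk_of_subset h

theorem exists_lift (f : N ↪[L] P) (g : N' ↪[L] P) (h : ∀ x, f x ∈ g.toHom.range) :
    ∃ k : N ↪[L] N', g.comp k = f := by
  refine ⟨g.equivRange.symm.toEmbedding.comp (f.codRestrict _ h), ?_⟩
  ext x
  have := g.equivRange_apply (g.equivRange.symm (f.codRestrict _ h x))
  rw [Language.Equiv.apply_symm_apply] at this
  exact this.symm

/-- A relation which is invariant under embeddings only depends on quantifier-free types. -/
theorem transfer_of_qfEq (hK : IsUniversalClass K)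
    (R : ∀ {N : Type u} [L.Structure N], L.Substructure N → L.Substructure N → N → Prop)
    (hR : ∀ {N N' : Type u} [L.Structure N] [L.Structure N'] (g : N ↪[L] N') (A B : L.Substructure N)
      (a : N), K N → K N' → (R A B a ↔ R (A.map g.toHom) (B.map g.toHom) (g a)))
    {M : Type u} [L.Structure M] (hN : K N) (hN' : K N') {e : M ↪[L] N} {e' : M ↪[L] N'}
    {a : N} {a' : N'} (h : QfEq L (pt e a) (pt e' a')) {A : L.Substructure M}
    (hA : R (A.map e.toHom) e.toHom.range a) : R (A.map e'.toHom) e'.toHom.range a' := by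
  obtain ⟨C, _, hC, i, c, f, f', rfl, rfl, rfl, rfl, -⟩ := exists_common_of_qfEq hK hN h
  rw [← map_map_embedding, ← map_range] at hA ⊢
  exact (hR f' _ _ _ hC hN').1 ((hR f _ _ _ hC hN).2 hA)

end Maps

/-! ### Nonforking over models of size `lam` in arbitrary members of the class -/

/-- The relation `nf` for `A ≤ B` inside an arbitrary extension of the ambient model. -/
def PreFrame.Indep {F : Set Cardinal.{u}} (s : PreFrame K F) {N : Type u} [L.Structure N]
    (A B : L.Substructure N) (a : N) : Prop :=
  ∃ (N₁ : Type u) (_ : L.Structure N₁) (f : N₁ ↪[L] N) (A₁ B₁ : L.Substructure N₁) (a₁ : N₁),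
    s.nf A₁ B₁ a₁ ∧ A₁.map f.toHom = A ∧ B₁.map f.toHom = B ∧ f a₁ = a

theorem restr_substructure (hK : IsUniversalClass K) {lam : Cardinal.{u}} (hlam : LS L ≤ lam)
    {N : Type u} [L.Structure N] (hN : K N) {F : Set Cardinal.{u}} (hF : F ⊆ Set.Ici lam)
    {S : L.Substructure N} (hS : #S ∈ F) : K.restr F S := by
  have : Nonempty S := by
    rw [← mk_ne_zero_iff]
    exact ((aleph0_pos.trans_le aleph0_le_LS).trans_le (hlam.trans (hF hS))).ne'
  exact ⟨hK.of_embedding S.subtype hN, hS⟩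

section Indep

variable {lam : Cardinal.{u}} {s : PreFrame K {lam}}
  {N N' : Type u} [L.Structure N] [L.Structure N'] {A B : L.Substructure N} {a : N}

theorem indep_of_nf (h : s.nf A B a) : s.Indep A B a :=
  ⟨N, inferInstance, Embedding.refl L N, A, B, a, h, by simp, by simp, rfl⟩

theorem PreFrame.Indep.map (h : s.Indep A B a) (g : N ↪[L] N') :
    s.Indep (A.map g.toHom) (B.map g.toHom) (g a) := by
  obtain ⟨N₁, _, f, A₁, B₁, a₁, h, rfl, rfl, rfl⟩ := h
  exact ⟨N₁, inferInstance, g.comp f, A₁, B₁, a₁, h, (map_map_embedding _ _ _).symm,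
    (map_map_embedding _ _ _).symm, rfl⟩

/-- The witness `N₁` need not map into the image of `g`. The model generated by `a₁` and `B₁` does,
still has size `lam`, and by monotonicity in the ambient model it is a witness as well. -/
theorem PreFrame.Indep.of_map (hK : IsUniversalClass K) (hlam : LS L ≤ lam) (g : N ↪[L] N')
    (h : s.Indep (A.map g.toHom) (B.map g.toHom) (g a)) : s.Indep A B a := by
  obtain ⟨N₁, _, f, A₁, B₁, a₁, h, hA, hB, ha⟩ := h
  obtain ⟨hAB, -, hB₁, hN₁⟩ := s.nf_dom h
  let C := Substructure.closure L (insert a₁ (B₁ : Set N₁))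
  have hBC : B₁ ≤ C := fun x hx => Substructure.subset_closure (Set.mem_insert_of_mem _ hx)
  have haC : a₁ ∈ C := Substructure.subset_closure (Set.mem_insert _ _)
  have hCcard : #C = lam :=
    le_antisymm ((mk_subtype_le _).trans_eq hN₁.2) (hB₁.2.symm.le.trans (card_mono hBC))
  have hC : K.restr {lam} C := restr_substructure hK hlam hN₁.1 (by simp) hCcard
  have hC' : C ≤ (g.toHom.range).comap f.toHom := by
    rw [Substructure.closure_le]
    rintro x (rfl | hx)
    · exact ⟨a, ha.symm⟩
    · have : f x ∈ B₁.map f.toHom := ⟨x, hx, rfl⟩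
      rw [hB] at this
      obtain ⟨y, -, hy⟩ := this
      exact ⟨y, hy⟩
  obtain ⟨k, hk⟩ := exists_lift (f.comp C.subtype) g fun x => hC' x.2
  refine ⟨C, inferInstance, k, A₁.comap C.subtype.toHom, B₁.comap C.subtype.toHom, ⟨a₁, haC⟩,
    ?_, ?_, ?_, ?_⟩
  · rw [s.nf_ambient C _ _ _ hN₁ hC, map_comap_subtype (hAB.trans hBC), map_comap_subtype hBC]
    exact h
  · apply map_embedding_injective g
    rw [map_map_embedding, hk, ← map_map_embedding, map_comap_subtype (hAB.trans hBC), hA]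
  · apply map_embedding_injective g
    rw [map_map_embedding, hk, ← map_map_embedding, map_comap_subtype hBC, hB]
  · apply g.injective
    rw [← ha]
    exact congrArg (fun h : C ↪[L] N' => h ⟨a₁, haC⟩) hk

theorem PreFrame.Indep.map_iff (hK : IsUniversalClass K) (hlam : LS L ≤ lam) (g : N ↪[L] N') :
    s.Indep (A.map g.toHom) (B.map g.toHom) (g a) ↔ s.Indep A B a :=
  ⟨fun h => h.of_map hK hlam g, fun h => h.map g⟩

theorem PreFrame.Indep.le (h : s.Indep A B a) : A ≤ B := by
  obtain ⟨N₁, _, f, A₁, B₁, a₁, h, rfl, rfl, rfl⟩ := h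
  exact Substructure.monotone_map (s.nf_dom h).1

theorem PreFrame.Indep.card_left (h : s.Indep A B a) : #A = lam := by
  obtain ⟨N₁, _, f, A₁, B₁, a₁, h, rfl, rfl, rfl⟩ := h
  rw [card_map_embedding]
  exact (s.nf_dom h).2.1.2

theorem PreFrame.Indep.card_right (h : s.Indep A B a) : #B = lam := by
  obtain ⟨N₁, _, f, A₁, B₁, a₁, h, rfl, rfl, rfl⟩ := h
  rw [card_map_embedding]
  exact (s.nf_dom h).2.2.1.2

/-- Raising the base to `B` makes the type of `a` over `B` basic, hence nonalgebraic. -/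
theorem PreFrame.Indep.notMem (hK : IsUniversalClass K) (h : s.Indep A B a) : a ∉ B := by
  obtain ⟨N₁, _, f, A₁, B₁, a₁, h, rfl, rfl, rfl⟩ := h
  obtain ⟨hAB, -, hB₁, hN₁⟩ := s.nf_dom h
  have h1 := s.nf_basic hN₁.1 (s.nf_mono h hAB le_rfl le_rfl hB₁ hB₁)
  have h2 := (gtp_mem_nonalgebraic_iff hK).1 (s.bs_dom _ _ h1).2
  rintro ⟨y, hy, hya⟩
  exact h2 ⟨⟨y, hy⟩, f.injective hya⟩

theorem PreFrame.Indep.mono (hK : IsUniversalClass K) (hlam : LS L ≤ lam)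
    {A' B' : L.Substructure N} (h : s.Indep A B a) (hA : A ≤ A') (hAB : A' ≤ B') (hB : B' ≤ B)
    (hc : #A' = lam) : s.Indep A' B' a := by
  have hc' : #B' = lam :=
    le_antisymm ((card_mono hB).trans_eq h.card_right) (hc.symm.le.trans (card_mono hAB))
  obtain ⟨N₁, _, f, A₁, B₁, a₁, h, rfl, rfl, rfl⟩ := h
  obtain ⟨hAB₁, -, hB₁, hN₁⟩ := s.nf_dom h
  have hBr : B' ≤ f.toHom.range := hB.trans Hom.map_le_range
  have eB := map_comap_of_le_range f hBr
  have eA := map_comap_of_le_range f (hAB.trans hBr)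
  refine ⟨N₁, inferInstance, f, A'.comap f.toHom, B'.comap f.toHom, a₁,
    s.nf_mono h ?_ (Substructure.monotone_comap hAB) ?_ ?_ ?_, eA, eB, rfl⟩
  · rwa [← map_embedding_le_iff f, eA]
  · rwa [← map_embedding_le_iff f, eB]
  · refine restr_substructure hK hlam hN₁.1 (by simp) ?_
    rw [← card_map_embedding f, eA]; exact hc
  · refine restr_substructure hK hlam hN₁.1 (by simp) ?_
    rw [← card_map_embedding f, eB]; exact hc'

/-- `DoesNotFork` speaks of some representative of the type; invariance under quantifier-free
equivalence lets any representative be tested, in an ambient model of any size. -/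
theorem doesNotFork_gtp_iff (hK : IsUniversalClass K) (hlam : LS L ≤ lam) {M : Type u}
    [L.Structure M] (hN : K N) {e : M ↪[L] N} {A : L.Substructure M} :
    s.DoesNotFork (gtp hN e a) A ↔ s.Indep (A.map e.toHom) e.toHom.range a := by
  constructor
  · rintro ⟨N', _, hN', e', a', h, hnf⟩
    exact transfer_of_qfEq hK (fun A B a => s.Indep A B a)
      (fun g A B a _ _ => (PreFrame.Indep.map_iff hK hlam g).symm) hN' hN ((gtp_eq_iff hK).1 h)
      (indep_of_nf hnf)
  · rintro ⟨N₁, _, f, A₁, B₁, a₁, h, hA, hB, rfl⟩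
    obtain ⟨k, rfl⟩ := exists_lift e f fun x => by
      have : e x ∈ e.toHom.range := ⟨x, rfl⟩
      rw [← hB] at this
      exact Hom.map_le_range this
    rw [← map_map_embedding] at hA
    rw [← map_range] at hB
    obtain rfl := map_embedding_injective f hA
    obtain rfl := map_embedding_injective f hB
    exact ⟨N₁, inferInstance, (s.nf_dom h).2.2.2.1, k, a₁, gtp_embedding f k a₁, h⟩

end Indep

/-! ### The axioms of the `lam`-frame inside ambient models of arbitrary size. -/

section GoodIndep

variable {lam : Cardinal.{u}} {s : GoodFrame K {lam}}

theorem GoodFrame.indep_unique (hK : IsUniversalClass K) (hlam : LS L ≤ lam)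
    {M N N' : Type u} [L.Structure M] [L.Structure N] [L.Structure N'] (hN : K N) (hN' : K N')
    {A : L.Substructure M} {e : M ↪[L] N} {e' : M ↪[L] N'} {a : N} {a' : N'}
    (h : s.Indep (A.map e.toHom) e.toHom.range a)
    (h' : s.Indep (A.map e'.toHom) e'.toHom.range a')
    (hA : QfEq L (pt (e.comp A.subtype) a) (pt (e'.comp A.subtype) a')) :
    QfEq L (pt e a) (pt e' a') := by
  rw [← gtp_eq_iff hK (hN := hN) (hN' := hN')]
  refine s.uniqueness M A _ _ ((doesNotFork_gtp_iff hK hlam hN).2 h)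
    ((doesNotFork_gtp_iff hK hlam hN').2 h') ?_
  rw [restrict_gtp, restrict_gtp, gtp_eq_iff hK]
  exact hA

theorem GoodFrame.exists_indep_extension (hK : IsUniversalClass K) (hlam : LS L ≤ lam)
    (hs : s.TypeFull) {M N : Type u} [L.Structure M] [L.Structure N] (hM : K M) (hMc : #M = lam)
    (hN : K N) (A : L.Substructure M) (hA : #A = lam) (e : A ↪[L] N) (a : N)
    (ha : a ∉ Set.range e) :
    ∃ (N' : Type u) (_ : L.Structure N') (_ : K N') (e' : M ↪[L] N') (a' : N'),
      s.Indep (A.map e'.toHom) e'.toHom.range a' ∧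
        QfEq L (pt e a) (pt (e'.comp A.subtype) a') := by
  have hp : gtp hN e a ∈ s.bs A := by
    rw [hs A (restr_substructure hK hlam hM (by simp) hA), gtp_mem_nonalgebraic_iff hK]
    exact ha
  obtain ⟨q, -, hq, hnf⟩ := s.existence M A ⟨hM, hMc⟩ _ hp
  obtain ⟨N', _, hN', e', a', rfl⟩ := exists_eq_gtp q
  rw [restrict_gtp] at hq
  exact ⟨N', inferInstance, hN', e', a', (doesNotFork_gtp_iff hK hlam hN').1 hnf,
    (gtp_eq_iff hK).1 hq.symm⟩

theorem GoodFrame.indep_trans (hK : IsUniversalClass K) (hlam : LS L ≤ lam) {N : Type u}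
    [L.Structure N] (hN : K N) {A B C : L.Substructure N} {a : N} (h : s.Indep B C a)
    (h' : s.Indep A B a) : s.Indep A C a := by
  let M₁ := B.comap C.subtype.toHom
  let i := C.subtype.comp M₁.subtype
  have hM₁ : M₁.map C.subtype.toHom = B := map_comap_subtype h.le
  have hi : i.toHom.range = B := by
    rw [← hM₁]
    change (C.subtype.comp M₁.subtype).toHom.range = _
    rw [← map_range, Substructure.range_subtype]
  have hA : (A.comap i.toHom).map i.toHom = A := map_comap_of_le_range i (hi ▸ h'.le)
  have := s.transitivity C M₁ (A.comap i.toHom) (gtp hN C.subtype a)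
    ((doesNotFork_gtp_iff hK hlam hN).2 (by rwa [hM₁, Substructure.range_subtype]))
    (by
      rw [restrict_gtp, doesNotFork_gtp_iff hK hlam hN]
      change s.Indep ((A.comap i.toHom).map i.toHom) i.toHom.range a
      rwa [hA, hi])
  rw [doesNotFork_gtp_iff hK hlam hN, Substructure.range_subtype, map_map_embedding] at this
  change s.Indep ((A.comap i.toHom).map i.toHom) C a at this
  rwa [hA] at this

theorem GoodFrame.exists_indep_of_chain (hK : IsUniversalClass K) (hlam : LS L ≤ lam)
    (hs : s.TypeFull) {N : Type u} [L.Structure N] (hN : K N) {B : L.Substructure N} {a : N}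
    (hB : #B = lam) (ha : a ∉ B) {δ : Ordinal.{u}} (hδ : Order.IsSuccLimit δ)
    (M : Ordinal.{u} → L.Substructure N) (hM : ∀ i < δ, #(M i) = lam)
    (hmono : ∀ i j, i ≤ j → j < δ → M i ≤ M j)
    (hcont : ∀ j < δ, Order.IsSuccLimit j → ∀ x ∈ M j, ∃ i < j, x ∈ M i)
    (hle : ∀ i < δ, M i ≤ B) (hunion : ∀ x ∈ B, ∃ i < δ, x ∈ M i) :
    ∃ i < δ, s.Indep (M i) B a := by
  have hBr : K.restr {lam} B := restr_substructure hK hlam hN (by simp) hB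
  have hmap : ∀ i < δ, ((M i).comap B.subtype.toHom).map B.subtype.toHom = M i := fun i hi =>
    map_comap_subtype (hle i hi)
  have hres : IsResolution (K.restr {lam}) B δ fun i => (M i).comap B.subtype.toHom := by
    refine ⟨hδ, fun i hi => restr_substructure hK hlam hBr.1 (by simp) ?_, fun i j hij hj =>
      Substructure.monotone_comap (hmono i j hij hj), fun j hj hjl => ?_, ?_⟩
    · rw [← card_map_embedding B.subtype, hmap i hi]
      exact hM i hi
    · ext x
      simp only [Set.mem_iUnion]
      constructor
      · intro hx
        obtain ⟨i, hi, hxi⟩ := hcont j hj hjl x hx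
        exact ⟨i, hi, hxi⟩
      · rintro ⟨i, hi, hx⟩
        exact hmono i j (le_of_lt hi) hj hx
    · refine Set.eq_univ_of_forall fun x => ?_
      obtain ⟨i, hi, hxi⟩ := hunion x x.2
      simp only [Set.mem_iUnion]
      exact ⟨i, hi, hxi⟩
  obtain ⟨i, hi, h⟩ := s.localCharacter B δ _ hBr hres (gtp hN B.subtype a) (by
    rw [hs B hBr, gtp_mem_nonalgebraic_iff hK]
    rintro ⟨x, rfl⟩
    exact ha x.2)
  rw [doesNotFork_gtp_iff hK hlam hN, hmap i hi, Substructure.range_subtype] at h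
  exact ⟨i, hi, h⟩

/-- The axiom yields a model `M₁` in some extension `N'`. Shrinking `M₁` to what `a` and `A`
generate gives a model already present in `N`, so the conclusion can be pulled back and names an
explicit right-hand side. -/
theorem GoodFrame.indep_symm (hK : IsUniversalClass K) (hlam : LS L ≤ lam) (hs : s.TypeFull)
    {N : Type u} [L.Structure N] {A C : L.Substructure N} {a b : N}
    (h : s.Indep A C a) (hb : b ∈ C) (hbA : b ∉ A) :
    s.Indep A (Substructure.closure L (insert a (A : Set N))) b := by
  obtain ⟨N₁, _, f, A₁, C₁, a₁, h, rfl, rfl, rfl⟩ := h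
  obtain ⟨b₁, hb₁, rfl⟩ := hb
  obtain ⟨-, hA₁, hC₁, hN₁⟩ := s.nf_dom h
  have hb₁A : b₁ ∉ A₁ := fun h => hbA ⟨b₁, h, rfl⟩
  obtain ⟨N', _, g, M₁, hM₁, hnf⟩ := s.symmetry N₁ hN₁.1 A₁ C₁ a₁ b₁ h hb₁ (by
    rw [hs A₁ hA₁, gtp_mem_nonalgebraic_iff hK]
    rintro ⟨x, rfl⟩
    exact hb₁A x.2)
  have e1 : Substructure.closure L (insert (f a₁) ((A₁.map f.toHom : L.Substructure N) : Set N)) =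
      (Substructure.closure L (insert a₁ (A₁ : Set N₁))).map f.toHom := by
    rw [Substructure.map_closure, Set.image_insert_eq]; rfl
  have e2 : Substructure.closure L (insert (g a₁) ((A₁.map g.toHom : L.Substructure N') : Set N')) =
      (Substructure.closure L (insert a₁ (A₁ : Set N₁))).map g.toHom := by
    rw [Substructure.map_closure, Set.image_insert_eq]; rfl
  change s.Indep _ (Substructure.closure L (insert (f a₁) _)) (f b₁)
  rw [e1]
  refine PreFrame.Indep.map (PreFrame.Indep.of_map hK hlam g ?_) f
  rw [← e2]
  refine (indep_of_nf hnf).mono hK hlam le_rfl ?_ ?_ (indep_of_nf hnf).card_left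
  · exact fun x hx => Substructure.subset_closure (Set.mem_insert_of_mem _ hx)
  · rw [Substructure.closure_le]
    rintro x (rfl | hx)
    exacts [hM₁, (s.nf_dom hnf).1 hx]

end GoodIndep

/-! ### Nonforking over a small base, with an arbitrary right-hand side -/

/-- `a` is nonforking from `M` over `A`, where `A` has size `lam`: this is tested on the
submodels of `M` of size `lam` that contain `A`. -/
structure PreFrame.IndepOver {lam : Cardinal.{u}} (s : PreFrame K {lam}) {N : Type u}
    [L.Structure N] (A M : L.Substructure N) (a : N) : Prop where
  le : A ≤ M
  card : #A = lam
  indep : ∀ B : L.Substructure N, A ≤ B → B ≤ M → #B = lam → s.Indep A B a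

theorem card_finite_le {lam : Cardinal.{u}} (hlam : LS L ≤ lam) {N : Type u} {X : Set N}
    (hX : X.Finite) : #X ≤ lam :=
  (lt_aleph0_iff_set_finite.2 hX).le.trans (aleph0_le_LS.trans hlam)

section Cardinality

variable {lam : Cardinal.{u}} {N : Type u} [L.Structure N]

/-- Downward Löwenheim–Skolem: `B` is generated by `A` and `X`. -/
theorem exists_between (hlam : LS L ≤ lam) {A M : L.Substructure N} (hA : #A = lam) (hAM : A ≤ M)
    {X : Set N} (hX : X ⊆ M) (hXc : #X ≤ lam) :
    ∃ B : L.Substructure N, A ≤ B ∧ B ≤ M ∧ X ⊆ B ∧ #B = lam := by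
  have hAB : A ≤ Substructure.closure L ((A : Set N) ∪ X) := fun x hx =>
    Substructure.subset_closure (Or.inl hx)
  refine ⟨_, hAB, Substructure.closure_le.2 (Set.union_subset hAM hX),
    fun x hx => Substructure.subset_closure (Or.inr hx), le_antisymm ?_ ?_⟩
  · exact card_closure_le hlam ((mk_union_le _ _).trans
      (add_le_of_le (aleph0_le_LS.trans hlam) hA.le hXc))
  · exact hA.symm.le.trans (card_mono hAB)

theorem exists_substructure_card (hlam : LS L ≤ lam) {M : L.Substructure N} (hM : lam ≤ #M) :
    ∃ A : L.Substructure N, A ≤ M ∧ #A = lam := by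
  obtain ⟨X, hXM, hX⟩ := (le_mk_iff_exists_subset (s := (M : Set N))).1 hM
  refine ⟨Substructure.closure L X, Substructure.closure_le.2 hXM,
    le_antisymm (card_closure_le hlam hX.le) ?_⟩
  exact hX.symm.le.trans (mk_le_mk_of_subset Substructure.subset_closure)

end Cardinality

/-! ### Transitivity, uniqueness, local character and symmetry for large right-hand sides. -/

section IndepOver

variable {lam : Cardinal.{u}}
  {N N' : Type u} [L.Structure N] [L.Structure N'] {A M : L.Substructure N} {a : N}

theorem PreFrame.IndepOver.map_iff {s : PreFrame K {lam}} (hK : IsUniversalClass K)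
    (hlam : LS L ≤ lam) (g : N ↪[L] N') :
    s.IndepOver (A.map g.toHom) (M.map g.toHom) (g a) ↔ s.IndepOver A M a := by
  constructor
  · rintro ⟨h1, h2, h3⟩
    rw [card_map_embedding] at h2
    refine ⟨(map_embedding_le_iff g).1 h1, h2, fun B hAB hBM hB => ?_⟩
    rw [← PreFrame.Indep.map_iff hK hlam g]
    exact h3 _ ((map_embedding_le_iff g).2 hAB) ((map_embedding_le_iff g).2 hBM)
      (by rwa [card_map_embedding])
  · rintro ⟨h1, h2, h3⟩
    refine ⟨(map_embedding_le_iff g).2 h1, by rwa [card_map_embedding], fun B hAB hBM hB => ?_⟩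
    have hB' := map_comap_of_le_range g (hBM.trans Hom.map_le_range)
    rw [← hB', map_embedding_le_iff] at hAB hBM
    rw [← hB', card_map_embedding] at hB
    rw [← hB']
    exact (h3 _ hAB hBM hB).map g

theorem PreFrame.IndepOver.notMem {s : PreFrame K {lam}} (hK : IsUniversalClass K)
    (hlam : LS L ≤ lam) (h : s.IndepOver A M a) : a ∉ M := by
  intro ha
  obtain ⟨B, hAB, hBM, haB, hB⟩ := exists_between hlam h.card h.le
    (X := {a}) (Set.singleton_subset_iff.2 ha) (card_finite_le hlam (Set.finite_singleton a))
  exact (h.indep B hAB hBM hB).notMem hK (haB rfl)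

theorem PreFrame.IndepOver.mono {s : PreFrame K {lam}} (hK : IsUniversalClass K)
    (hlam : LS L ≤ lam) (h : s.IndepOver A M a) {A' M' : L.Substructure N} (hA : A ≤ A')
    (hAM : A' ≤ M') (hM : M' ≤ M) (hc : #A' = lam) : s.IndepOver A' M' a :=
  ⟨hAM, hc, fun B hAB hBM hB =>
    (h.indep B (hA.trans hAB) (hBM.trans hM) hB).mono hK hlam hA hAB le_rfl hc⟩

variable {s : GoodFrame K {lam}}

/-- `A` and `A'` need not be comparable. Given a small `B`, choose a small `A''` in `M` containing
both and a small `B''` in `M'` containing `B` and `A''`; transitivity in `lam` along `A ≤ A'' ≤ B''`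
gives the claim after shrinking to `B`. -/
theorem GoodFrame.indepOver_trans (hK : IsUniversalClass K) (hlam : LS L ≤ lam) (hN : K N)
    {A' M' : L.Substructure N} (h : s.IndepOver A' M' a) (hA' : A' ≤ M) (hM : M ≤ M')
    (h' : s.IndepOver A M a) : s.IndepOver A M' a := by
  refine ⟨h'.le.trans hM, h'.card, fun B hAB hBM hB => ?_⟩
  obtain ⟨A'', hA1, hA2, hA3, hA4⟩ := exists_between hlam h'.card h'.le (X := (A' : Set N)) hA'
    h.card.le
  obtain ⟨B'', hB1, hB2, hB3, hB4⟩ := exists_between hlam hB hBM (X := (A'' : Set N))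
    (hA2.trans hM) hA4.le
  have h1 := (h.indep B'' (hA3.trans hB3) hB2 hB4).mono hK hlam hA3 hB3 le_rfl hA4
  exact (s.indep_trans hK hlam hN h1 (h'.indep A'' hA1 hA2 hA4)).mono hK hlam le_rfl hAB hB1
    h'.card

/-- By locality it suffices to compare the types over small `B`. The two bases may differ: both are
raised to a common small `A₂` inside `M`, where the types agree by hypothesis, and uniqueness in
`lam` applies. -/
theorem GoodFrame.indepOver_unique (hK : IsUniversalClass K) (hlam : LS L ≤ lam)
    {P : Type u} [L.Structure P] (hN : K N) (hN' : K N') {A A' : L.Substructure P}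
    {M : L.Substructure P} (hA : A ≤ M) (hA' : A' ≤ M) {e : P ↪[L] N} {e' : P ↪[L] N'} {a : N}
    {a' : N'} (h : s.IndepOver (A.map e.toHom) e.toHom.range a)
    (h' : s.IndepOver (A'.map e'.toHom) e'.toHom.range a')
    (hM : QfEq L (pt (e.comp M.subtype) a) (pt (e'.comp M.subtype) a')) :
    QfEq L (pt e a) (pt e' a') := by
  have hAc := h.card
  have hAc' := h'.card
  rw [card_map_embedding] at hAc hAc'
  obtain ⟨A₂, h1, h2, h3, h4⟩ := exists_between hlam hAc hA (X := (A' : Set P)) hA' hAc'.le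
  refine QfEq.of_finite fun t => ?_
  obtain ⟨B, hB1, -, hB2, hB3⟩ := exists_between (M := ⊤) hlam h4 le_top
    (X := {x | some x ∈ t}) (Set.subset_univ _)
    (card_finite_le hlam (t.finite_toSet.preimage (Option.some_injective _).injOn))
  let C := A₂.comap B.subtype.toHom
  have hC : C.map B.subtype.toHom = A₂ := map_comap_subtype hB1
  have key : QfEq L (pt (e.comp B.subtype) a) (pt (e'.comp B.subtype) a') := by
    refine s.indep_unique hK hlam hN hN' (A := C) ?_ ?_ ?_
    · rw [← map_map_embedding, hC, ← map_range, Substructure.range_subtype]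
      refine (h.indep (B.map e.toHom) ((map_embedding_le_iff e).2 (h1.trans hB1))
        Hom.map_le_range (by rwa [card_map_embedding])).mono hK hlam
        ((map_embedding_le_iff e).2 h1) ((map_embedding_le_iff e).2 hB1) le_rfl
        (by rwa [card_map_embedding])
    · rw [← map_map_embedding, hC, ← map_range, Substructure.range_subtype]
      have h3' : A' ≤ A₂ := h3
      refine (h'.indep (B.map e'.toHom) ((map_embedding_le_iff e').2 (h3'.trans hB1))
        Hom.map_le_range (by rwa [card_map_embedding])).mono hK hlam
        ((map_embedding_le_iff e').2 h3') ((map_embedding_le_iff e').2 hB1) le_rfl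
        (by rwa [card_map_embedding])
    · have := hM.comp (Option.map fun x : C => (⟨x, h2 x.2⟩ : M))
      convert this using 1 <;> · funext o; cases o <;> rfl
  refine ⟨{none} ∪ some '' (B : Set P), ?_, ?_⟩
  · rintro (_ | x) hx
    · exact Or.inl rfl
    · exact Or.inr ⟨x, hB2 hx, rfl⟩
  · exact (qfEqOn_pt_iff (B : Set P)).2 key

/-- If every small `A` failed, some small `B` above it would witness the failure. Iterating `ω`
times gives a chain whose union has size `lam` and violates local character in `lam`. -/
theorem GoodFrame.exists_indepOver (hK : IsUniversalClass K) (hlam : LS L ≤ lam)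
    (hs : s.TypeFull) (hN : K N) (hM : lam ≤ #M) (ha : a ∉ M) : ∃ A, s.IndepOver A M a := by
  by_contra hcon
  have hstep : ∀ A : {A : L.Substructure N // A ≤ M ∧ #A = lam},
      ∃ B : {A : L.Substructure N // A ≤ M ∧ #A = lam}, A.1 ≤ B.1 ∧ ¬ s.Indep A.1 B.1 a := by
    intro A
    by_contra h
    push Not at h
    exact hcon ⟨A, A.2.1, A.2.2, fun B hAB hBM hB => h ⟨B, hBM, hB⟩ hAB⟩
  choose f hf hf' using hstep
  obtain ⟨A₀, hA₀⟩ := exists_substructure_card hlam hM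
  let S : ℕ → {A : L.Substructure N // A ≤ M ∧ #A = lam} := fun n => f^[n] ⟨A₀, hA₀⟩
  have hS : ∀ n, S (n + 1) = f (S n) := fun n => Function.iterate_succ_apply' f n _
  have hSmono : Monotone fun n => (S n).1 := monotone_nat_of_le_succ fun n => by
    rw [hS]; exact hf _
  -- Local character takes chains indexed by ordinals; only the values at natural numbers matter.
  let T : Ordinal.{u} → L.Substructure N := fun i => ⨆ n : {n : ℕ // (n : Ordinal.{u}) ≤ i}, (S n).1
  have hT : ∀ n : ℕ, T n = (S n).1 := fun n =>
    le_antisymm (iSup_le fun m => hSmono (Nat.cast_le.1 m.2))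
      (le_iSup (fun m : {m : ℕ // (m : Ordinal.{u}) ≤ n} => (S m).1) ⟨n, le_rfl⟩)
  let B : L.Substructure N := ⨆ n, (S n).1
  have hSB : ∀ n, (S n).1 ≤ B := fun n => le_iSup (fun n => (S n).1) n
  have hBmem : ∀ x ∈ B, ∃ n, x ∈ (S n).1 := fun x hx =>
    (Substructure.mem_iSup_of_directed hSmono.directed_le).1 hx
  have hBM : B ≤ M := iSup_le fun n => (S n).2.1
  have hBc : #B = lam := by
    refine le_antisymm ?_ ((S 0).2.2.symm.le.trans (card_mono (hSB 0)))
    have h1 : (B : Set N) = ⋃ n : ULift.{u} ℕ, ((S n.down).1 : Set N) := by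
      ext x
      simp only [Set.mem_iUnion]
      exact ⟨fun hx => (hBmem x hx).imp' ULift.up fun _ h => h, fun ⟨n, hx⟩ => hSB _ hx⟩
    have h2 : #B ≤ Cardinal.sum fun n : ULift.{u} ℕ => #(S n.down).1 := by
      have := mk_iUnion_le_sum_mk (f := fun n : ULift.{u} ℕ => ((S n.down).1 : Set N))
      rw [← h1] at this
      exact this
    refine h2.trans ?_
    simp only [(S _).2.2, sum_const, mk_uLift, mk_nat, lift_aleph0, Cardinal.lift_id]
    exact mul_le_of_le (aleph0_le_LS.trans hlam) (aleph0_le_LS.trans hlam) le_rfl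
  obtain ⟨i, hi, h⟩ := s.exists_indep_of_chain hK hlam hs hN hBc (fun h => ha (hBM h))
    Ordinal.isSuccLimit_omega0 T (fun i hi => by
      obtain ⟨n, rfl⟩ := Ordinal.lt_omega0.1 hi
      rw [hT]; exact (S n).2.2)
    (fun i j hij hj => by
      obtain ⟨n, rfl⟩ := Ordinal.lt_omega0.1 hj
      obtain ⟨m, rfl⟩ := Ordinal.lt_omega0.1 (hij.trans_lt hj)
      rw [hT, hT]; exact hSmono (Nat.cast_le.1 hij))
    (fun j hj hl => absurd (Ordinal.omega0_le_of_isSuccLimit hl) hj.not_ge)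
    (fun i hi => by
      obtain ⟨n, rfl⟩ := Ordinal.lt_omega0.1 hi
      rw [hT]; exact hSB n)
    (fun x hx => by
      obtain ⟨n, hn⟩ := hBmem x hx
      exact ⟨n, Ordinal.natCast_lt_omega0 n, by rwa [hT]⟩)
  obtain ⟨n, rfl⟩ := Ordinal.lt_omega0.1 hi
  rw [hT] at h
  refine hf' (S n) ?_
  rw [← hS]
  exact h.mono hK hlam le_rfl (hSmono n.le_succ) (hSB _) (S n).2.2

/-- Fix a small `B` in `M` over which `a` is nonforking from `M`. The intersections `B ⊓ S i` form a
continuous chain with union `B`, so local character in `lam` gives an `i` such that `a` is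
nonforking from `B` over `B ⊓ S i`, and transitivity replaces `B` by `M`. No condition on the
cofinality of `δ` is needed. -/
theorem GoodFrame.exists_indepOver_of_chain (hK : IsUniversalClass K) (hlam : LS L ≤ lam)
    (hs : s.TypeFull) (hN : K N) (ha : a ∉ M) {δ : Ordinal.{u}} (hδ : Order.IsSuccLimit δ)
    (S : Ordinal.{u} → L.Substructure N) (hS : ∀ i < δ, lam ≤ #(S i))
    (hmono : ∀ i j, i ≤ j → j < δ → S i ≤ S j)
    (hcont : ∀ j < δ, Order.IsSuccLimit j → ∀ x ∈ S j, ∃ i < j, x ∈ S i)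
    (hle : ∀ i < δ, S i ≤ M) (hunion : ∀ x ∈ M, ∃ i < δ, x ∈ S i) :
    ∃ i < δ, ∃ A ≤ S i, s.IndepOver A M a := by
  have h0 : (0 : Ordinal.{u}) < δ := hδ.bot_lt
  have hM : lam ≤ #M := (hS 0 h0).trans (card_mono (hle 0 h0))
  obtain ⟨A₀, hA₀, hA₀c⟩ := exists_substructure_card hlam (hS 0 h0)
  obtain ⟨A₁, hA₁⟩ := s.exists_indepOver hK hlam hs hN hM ha
  -- Including `A₀ ≤ S 0` in `B` forces every intersection to have size exactly `lam`.
  obtain ⟨B, hB1, hB2, hB3, hB4⟩ := exists_between hlam hA₁.card hA₁.le (X := (A₀ : Set N))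
    (hA₀.trans (hle 0 h0)) hA₀c.le
  have hB := hA₁.mono hK hlam hB1 hB2 le_rfl hB4
  have hc : ∀ i < δ, #(B ⊓ S i : L.Substructure N) = lam := fun i hi =>
    le_antisymm ((card_mono inf_le_left).trans_eq hB4)
      (hA₀c.symm.le.trans (card_mono (le_inf hB3 (hA₀.trans (hmono 0 i zero_le hi)))))
  obtain ⟨i, hi, h⟩ := s.exists_indep_of_chain hK hlam hs hN hB4 (fun h => ha (hB2 h)) hδ
    (fun i => B ⊓ S i) hc (fun i j hij hj => inf_le_inf le_rfl (hmono i j hij hj))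
    (fun j hj hl x hx => (hcont j hj hl x hx.2).imp fun i hi => ⟨hi.1, hx.1, hi.2⟩)
    (fun i _ => inf_le_left)
    (fun x hx => (hunion x (hB2 hx)).imp fun i hi => ⟨hi.1, hx, hi.2⟩)
  refine ⟨i, hi, B ⊓ S i, inf_le_right, s.indepOver_trans hK hlam hN hB le_rfl hB2 ⟨inf_le_left,
    hc i hi, fun C hC hCB hCc => h.mono hK hlam le_rfl hC hCB (hc i hi)⟩⟩

theorem GoodFrame.indepOver_symm (hK : IsUniversalClass K) (hlam : LS L ≤ lam)
    (hs : s.TypeFull) (hN : K N) {M₀ : L.Substructure N} {b : N} (hM₀ : M₀ ≤ M) (hA : A ≤ M₀)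
    (h : s.IndepOver A M a) (hb : b ∈ M) (hbM : b ∉ M₀) :
    ∃ A' ≤ M₀, s.IndepOver A' (Substructure.closure L (insert a (M₀ : Set N))) b := by
  obtain ⟨A₁, hA₁⟩ := s.exists_indepOver hK hlam hs hN (h.card.symm.le.trans (card_mono hA)) hbM
  obtain ⟨A', h1, h2, h3, h4⟩ := exists_between hlam hA₁.card hA₁.le (X := (A : Set N)) hA h.card.le
  have h3 : A ≤ A' := h3
  have hA' := hA₁.mono hK hlam h1 h2 le_rfl h4
  refine ⟨A', h2, fun x hx => Substructure.subset_closure (Set.mem_insert_of_mem _ (h2 hx)), h4,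
    fun B hAB hBM hB => ?_⟩
  -- Each element of `B` uses only finitely many parameters from `M₀`, so `lam` parameters generate
  -- all of `B` together with `a`.
  have hex : ∃ M' : L.Substructure N, A' ≤ M' ∧ M' ≤ M₀ ∧ #M' = lam ∧
      B ≤ Substructure.closure L (insert a (M' : Set N)) := by
    have hfin : ∀ x : B, ∃ t : Set N, t.Finite ∧ t ⊆ M₀ ∧
        (x : N) ∈ Substructure.closure L (insert a t) := by
      intro x
      have hx := hBM x.2
      refine Substructure.closure_induction (p := fun x => ∃ t : Set N, t.Finite ∧ t ⊆ M₀ ∧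
        x ∈ Substructure.closure L (insert a t)) hx ?_ ?_
      · rintro y (rfl | hy)
        · exact ⟨∅, Set.finite_empty, Set.empty_subset _,
            Substructure.subset_closure (Set.mem_insert _ _)⟩
        · exact ⟨{y}, Set.finite_singleton y, Set.singleton_subset_iff.2 hy,
            Substructure.subset_closure (Set.mem_insert_of_mem _ rfl)⟩
      · intro n F xs hxs
        choose t ht1 ht2 ht3 using hxs
        refine ⟨⋃ i, t i, Set.finite_iUnion ht1, Set.iUnion_subset ht2,
          Substructure.fun_mem _ F xs fun i => ?_⟩
        exact Substructure.closure_mono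
          (Set.insert_subset_insert (Set.subset_iUnion t i)) (ht3 i)
    choose t ht1 ht2 ht3 using hfin
    obtain ⟨M', hM1, hM2, hM3, hM4⟩ := exists_between hlam h4 h2 (X := ⋃ x, t x)
      (Set.iUnion_subset ht2) (by
        refine (mk_iUnion_le_sum_mk).trans ((sum_le_sum _ (fun _ => lam) fun x =>
          card_finite_le hlam (ht1 x)).trans ?_)
        rw [sum_const, hB, Cardinal.lift_id]
        exact (mul_eq_self (aleph0_le_LS.trans hlam)).le)
    exact ⟨M', hM1, hM2, hM4, fun x hx => Substructure.closure_mono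
      (Set.insert_subset_insert ((Set.subset_iUnion t ⟨x, hx⟩).trans hM3)) (ht3 ⟨x, hx⟩)⟩
  obtain ⟨M', hM1, hM2, hM3, hM4⟩ := hex
  obtain ⟨C, hC1, hC2, hC3, hC4⟩ := exists_between hlam hM3 (hM2.trans hM₀) (X := {b})
    (Set.singleton_subset_iff.2 hb) (card_finite_le hlam (Set.finite_singleton b))
  -- Symmetry in `lam` is applied over `M'`; transitivity then lowers the base to `A'`.
  have k1 := (h.indep C ((h3.trans hM1).trans hC1) hC2 hC4).mono hK hlam (h3.trans hM1) hC1 le_rfl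
    hM3
  have k2 := s.indep_symm hK hlam hs k1 (hC3 rfl) fun h => hbM (hM2 h)
  exact (s.indep_trans hK hlam hN k2 (hA'.indep M' hM1 hM2 hM3)).mono hK hlam le_rfl hAB hM4 h4

end IndepOver

/-! ### Extension of types -/

section Extension

variable {lam : Cardinal.{u}} {s : GoodFrame K {lam}}

/-- One piece of the family to be glued: the nonforking extension to a single small `B`. -/
theorem GoodFrame.exists_triple_indep (hK : IsUniversalClass K) (hlam : LS L ≤ lam)
    (hs : s.TypeFull) {P N : Type u} [L.Structure P] [L.Structure N] (hP : K P) (hN : K N)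
    {A B : L.Substructure P} (hA : #A = lam) (hB : #B = lam) (hAB : A ≤ B) (e : A ↪[L] N) (a : N)
    (ha : a ∉ Set.range e) :
    ∃ r : Triple K B,
      s.Indep ((A.comap B.subtype.toHom).map r.emb.toHom) r.emb.toHom.range r.a ∧
        QfEq L (pt e a) (pt (r.emb.comp (Substructure.inclusion hAB)) r.a) := by
  let A' := A.comap B.subtype.toHom
  have hA' : #A' = lam := by
    rw [← card_map_embedding B.subtype, map_comap_subtype hAB]; exact hA
  let k : A' ↪[L] A := (B.subtype.comp A'.subtype).codRestrict A fun x => x.2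
  obtain ⟨N', _, hN', e', a', h1, h2⟩ := s.exists_indep_extension hK hlam hs
    (restr_substructure hK hlam hP (by simp) hB : K.restr {lam} B).1 hB hN A' hA' (e.comp k) a
    (by rintro ⟨x, hx⟩; exact ha ⟨k x, hx⟩)
  refine ⟨⟨N', hN', e', a'⟩, h1, ?_⟩
  have h3 := h2.comp (Option.map fun x : A => (⟨⟨x, hAB x.2⟩, x.2⟩ : A'))
  convert h3 using 1 <;> · funext o; cases o <;> rfl

/-- Nonforking extensions of nonalgebraic types from a model of size `lam` to any larger model. -/
theorem GoodFrame.exists_indepOver_extension (hK : IsUniversalClass K) (hlam : LS L ≤ lam)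
    (hs : s.TypeFull) {P N : Type u} [L.Structure P] [L.Structure N] (hP : K P) (hN : K N)
    {A : L.Substructure P} (hA : #A = lam) (e : A ↪[L] N) (a : N) (ha : a ∉ Set.range e) :
    ∃ (N' : Type u) (_ : L.Structure N') (_ : K N') (e' : P ↪[L] N') (a' : N'),
      s.IndepOver (A.map e'.toHom) e'.toHom.range a' ∧
        QfEq L (pt e a) (pt (e'.comp A.subtype) a') := by
  classical
  let ι : Type u := {B : L.Substructure P // A ≤ B ∧ #B = lam}
  choose r hr hr' using fun B : ι =>
    s.exists_triple_indep hK hlam hs hP hN hA B.2.2 B.2.1 e a ha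
  have hdir : IsDirectedOrder ι := ⟨fun B C => by
    obtain ⟨E, h1, -, h2, h3⟩ := exists_between (M := ⊤) hlam B.2.2 le_top (X := (C.1 : Set P))
      (Set.subset_univ _) C.2.2.le
    exact ⟨⟨E, B.2.1.trans h1, h3⟩, h1, h2⟩⟩
  have : Nonempty ι := ⟨⟨A, le_rfl, hA⟩⟩
  -- The value outside `B` is a dummy; gluing only looks at `B` and the extra point.
  let v : ∀ B : ι, Option P → (r B).N := fun B =>
    pt (fun x => if h : x ∈ B.1 then (r B).emb ⟨x, h⟩ else (r B).a) (r B).a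
  have hv : ∀ (B C : ι) (h : B ≤ C),
      (fun x : B.1 => if h : (x : P) ∈ C.1 then (r C).emb ⟨x, h⟩ else (r C).a) =
        (r C).emb.comp (Substructure.inclusion h) := by
    intro B C h
    funext x
    exact dif_pos (h x.2)
  obtain ⟨N', _, w, hN', hw⟩ := hK.exists_glue
    (fun B : ι => ({none} ∪ some '' (B.1 : Set P) : Set (Option P)))
    (fun B C h => Set.union_subset_union_right _ (Set.image_mono h))
    (fun B => ⟨none, Or.inl rfl⟩) (fun B => (r B).N) v (fun B => (r B).mem) (fun B C h => by
      refine (qfEqOn_pt_iff (B.1 : Set P)).2 ?_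
      have h1 := hv B B le_rfl
      have h2 := hv B C h
      change QfEq L (pt (fun x : B.1 => _) (r B).a) (pt (fun x : B.1 => _) (r C).a)
      rw [h1, h2]
      have h3 : (A.comap B.1.subtype.toHom).map (Substructure.inclusion h).toHom =
          A.comap C.1.subtype.toHom := by
        apply map_embedding_injective C.1.subtype
        rw [map_map_embedding]
        exact (map_comap_subtype B.2.1).trans (map_comap_subtype C.2.1).symm
      -- Coherence: the restriction of the extension over `C` to `B` is a nonforking extension of
      -- the same type over `A`.
      refine s.indep_unique hK hlam (r B).mem (r C).mem (A := A.comap B.1.subtype.toHom)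
        (e := (r B).emb.comp (Substructure.inclusion le_rfl)) (hr B) ?_ ?_
      · refine (hr C).mono hK hlam ?_ ?_ ?_ ?_
        · rw [← map_map_embedding, h3]
        · exact Hom.map_le_range
        · rw [← map_range]; exact Hom.map_le_range
        · rw [← map_map_embedding, h3]; exact (hr C).card_left
      · have h4 := ((hr' B).symm.trans (hr' C)).comp
          (Option.map fun x : A.comap B.1.subtype.toHom => (⟨x.1, x.2⟩ : A))
        convert h4 using 1 <;> · funext o; cases o <;> rfl)
  have hwpt : w = pt (fun x => w (some x)) (w none) := by funext o; cases o <;> rfl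
  have hw' : ∀ B : ι, QfEq L (pt (r B).emb (r B).a) (pt (fun x : B.1 => w (some x)) (w none)) := by
    intro B
    have h1 := hw B
    rw [hwpt] at h1
    have h2 := (qfEqOn_pt_iff (B.1 : Set P)).1 h1
    change QfEq L (pt (fun x : B.1 => _) (r B).a) _ at h2
    rw [hv B B le_rfl] at h2
    exact h2
  -- On points of `P` the glued family has the quantifier-free type of `P` itself, hence it is an
  -- embedding.
  have hid : QfEq L (id : P → P) fun x => w (some x) := by
    refine QfEq.of_finite fun t => ?_
    obtain ⟨B, hB1, -, hB2, hB3⟩ := exists_between (M := ⊤) hlam hA le_top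
      (X := (t : Set P)) (Set.subset_univ _) (card_finite_le hlam t.finite_toSet)
    refine ⟨B, hB2, ?_⟩
    have h1 : QfEq L (id : B → B) (r ⟨B, hB1, hB3⟩).emb := QfEq.embedding (r ⟨B, hB1, hB3⟩).emb id
    have h2 : QfEq L (id : B → B) B.subtype := QfEq.embedding B.subtype id
    exact (h2.symm.trans h1).trans ((hw' ⟨B, hB1, hB3⟩).comp some)
  obtain ⟨e', he'⟩ := hid.exists_embedding_of_id
  have hw'' : ∀ B : ι, QfEq L (pt (r B).emb (r B).a) (pt (e'.comp B.1.subtype) (w none)) := by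
    intro B
    have h1 : (fun x : B.1 => w (some x)) = e'.comp B.1.subtype := funext fun x => (he' x).symm
    rw [← h1]
    exact hw' B
  refine ⟨N', inferInstance, hN', e', w none, ⟨Hom.map_le_range, by rwa [card_map_embedding],
    fun B hAB hBe hB => ?_⟩, ?_⟩
  · have hB' := map_comap_of_le_range e' hBe
    rw [← hB', map_embedding_le_iff] at hAB
    rw [← hB', card_map_embedding] at hB
    have h1 := transfer_of_qfEq hK (fun A B a => s.Indep A B a)
      (fun g A B a _ _ => (PreFrame.Indep.map_iff hK hlam g).symm) (r ⟨_, hAB, hB⟩).mem hN'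
      (hw'' ⟨_, hAB, hB⟩) (hr ⟨_, hAB, hB⟩)
    rw [← map_map_embedding, map_comap_subtype hAB, ← map_range, Substructure.range_subtype,
      hB'] at h1
    exact h1
  · exact (hr' ⟨A, le_rfl, hA⟩).trans (hw'' ⟨A, le_rfl, hA⟩)

/-- Nonforking extensions of nonalgebraic types. -/
theorem GoodFrame.exists_nonforking_extension (hK : IsUniversalClass K) (hlam : LS L ≤ lam)
    (hs : s.TypeFull) {M P N : Type u} [L.Structure M] [L.Structure P] [L.Structure N]
    (hM : lam ≤ #M) (hP : K P) (hN : K N) (j : M ↪[L] P) (i : M ↪[L] N) (a : N)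
    (ha : a ∉ Set.range i) :
    ∃ (N' : Type u) (_ : L.Structure N') (_ : K N') (e' : P ↪[L] N') (a' : N')
      (A : L.Substructure M), s.IndepOver (A.map (e'.comp j).toHom) e'.toHom.range a' ∧
        QfEq L (pt i a) (pt (e'.comp j) a') := by
  obtain ⟨A, hA⟩ := s.exists_indepOver hK hlam hs hN (M := i.toHom.range) (a := a)
    (by rwa [card_range_embedding]) (by rintro ⟨x, hx⟩; exact ha ⟨x, hx⟩)
  obtain ⟨A, rfl⟩ : ∃ A' : L.Substructure M, A'.map i.toHom = A :=
    ⟨_, map_comap_of_le_range i hA.le⟩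
  have hAc := hA.card
  rw [card_map_embedding] at hAc
  let q : A.map j.toHom ↪[L] A := (j.substructureEquivMap A).symm.toEmbedding
  have hq : ∀ x : A, q ⟨j x, ⟨x, x.2, rfl⟩⟩ = x := fun x =>
    (j.substructureEquivMap A).symm_apply_apply x
  obtain ⟨N', _, hN', e', a', h1, h2⟩ := s.exists_indepOver_extension hK hlam hs hP hN
    (A := A.map j.toHom) (by rwa [card_map_embedding]) ((i.comp A.subtype).comp q) a
    (by rintro ⟨x, hx⟩; exact ha ⟨_, hx⟩)
  rw [map_map_embedding] at h1
  refine ⟨N', inferInstance, hN', e', a', A, h1, ?_⟩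
  -- The extension was built from the restriction to `A` only. Uniqueness over `A` shows that it
  -- restricts to the original type on all of `M`.
  refine s.indepOver_unique hK hlam hN hN' (A := A) (A' := A) (M := A) le_rfl le_rfl hA
    (h1.mono hK hlam le_rfl Hom.map_le_range ?_ h1.card) ?_
  · rw [← map_range]; exact Hom.map_le_range
  · have h3 := h2.comp (Option.map fun x : A => (⟨j x, ⟨x, x.2, rfl⟩⟩ : A.map j.toHom))
    convert h3 using 1
    · funext o
      cases o with
      | none => rfl
      | some x => exact congrArg (fun y : A => i y) (hq x).symm
    · funext o
      cases o <;> rfl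

/-- An algebraic type is realized in `P` itself; the others have nonforking extensions. -/
theorem GoodFrame.exists_extension (hK : IsUniversalClass K) (hlam : LS L ≤ lam)
    (hs : s.TypeFull) {M P N : Type u} [L.Structure M] [L.Structure P] [L.Structure N]
    (hM : lam ≤ #M) (hP : K P) (hN : K N) (j : M ↪[L] P) (i : M ↪[L] N) (a : N) :
    ∃ (N' : Type u) (_ : L.Structure N') (_ : K N') (e' : P ↪[L] N') (a' : N'),
      QfEq L (pt i a) (pt (e'.comp j) a') := by
  by_cases ha : a ∈ Set.range i
  · obtain ⟨m, rfl⟩ := ha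
    refine ⟨P, inferInstance, hP, Embedding.refl L P, j m, ?_⟩
    have h1 := QfEq.embedding i (pt id m)
    have h2 := QfEq.embedding j (pt id m)
    rw [comp_pt] at h1 h2
    exact h1.symm.trans h2
  · obtain ⟨N', _, hN', e', a', -, -, h⟩ :=
      s.exists_nonforking_extension hK hlam hs hM hP hN j i a ha
    exact ⟨N', inferInstance, hN', e', a', h⟩

end Extension

/-! ### Amalgamation -/

/-- An amalgam of `M₁` and of a submodel `A` of `M₂` over `M₀`. The values of `v` on the elements
of `M₂` outside of `A` are irrelevant. -/
structure PartialAmalgam (K : StrClass L) {M₀ M₁ M₂ : Type u} [L.Structure M₀] [L.Structure M₁]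
    [L.Structure M₂] (f₁ : M₀ ↪[L] M₁) (f₂ : M₀ ↪[L] M₂) where
  A : L.Substructure M₂
  N : Type u
  [str : L.Structure N]
  mem : K N
  v : M₁ ⊕ M₂ → N
  left : QfEq L (id : M₁ → M₁) (v ∘ Sum.inl)
  right : QfEqOn L (A : Set M₂) id (v ∘ Sum.inr)
  glue : ∀ m, v (Sum.inl (f₁ m)) = v (Sum.inr (f₂ m))
  le : f₂.toHom.range ≤ A

attribute [instance] PartialAmalgam.str

namespace PartialAmalgam

/-- The part of `M₁ ⊕ M₂` that matters for an amalgam of `M₁` and `A`. -/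
def dom {M₂ : Type u} [L.Structure M₂] (M₁ : Type u) (A : L.Substructure M₂) : Set (M₁ ⊕ M₂) :=
  Set.range Sum.inl ∪ Sum.inr '' (A : Set M₂)

theorem dom_mono {M₁ M₂ : Type u} [L.Structure M₂] {A B : L.Substructure M₂} (h : A ≤ B) :
    dom M₁ A ⊆ dom M₁ B :=
  Set.union_subset_union_right _ (Set.image_mono h)

variable {M₀ M₁ M₂ : Type u} [L.Structure M₀] [L.Structure M₁] [L.Structure M₂]
  {f₁ : M₀ ↪[L] M₁} {f₂ : M₀ ↪[L] M₂}

/-- Extension of partial amalgams. -/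
def Le (x y : PartialAmalgam K f₁ f₂) : Prop :=
  x.A ≤ y.A ∧ QfEqOn L (dom M₁ x.A) x.v y.v

theorem Le.trans {x y z : PartialAmalgam K f₁ f₂} (h : x.Le y) (h' : y.Le z) : x.Le z :=
  ⟨h.1.trans h'.1, QfEqOn.trans h.2 (h'.2.mono (dom_mono h.1))⟩

theorem nonempty [Nonempty M₁] (hM₁ : K M₁) : Nonempty (PartialAmalgam K f₁ f₂) := by
  classical
  -- The trivial amalgam: `M₁` together with the copy of `M₀` in `M₂`.
  let v : M₁ ⊕ M₂ → M₁ := Sum.elim id fun m =>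
    if h : ∃ m₀, f₂ m₀ = m then f₁ h.choose else Classical.arbitrary _
  have hv : ∀ m, v (Sum.inr (f₂ m)) = f₁ m := fun m => by
    have h : ∃ m₀, f₂ m₀ = f₂ m := ⟨m, rfl⟩
    simp only [v, Sum.elim_inr, dif_pos h]
    rw [f₂.injective h.choose_spec]
  refine ⟨⟨f₂.toHom.range, M₁, hM₁, v, QfEq.refl _, ?_, fun m => (hv m).symm, le_rfl⟩⟩
  have h1 : QfEq L (f₂ : M₀ → M₂) f₁ :=
    (QfEq.embedding f₂ id).symm.trans (QfEq.embedding f₁ id)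
  have hex : ∀ x : (f₂.toHom.range : Set M₂), ∃ m, f₂ m = x := fun x => x.2
  choose g hg using hex
  have h2 := h1.comp g
  unfold QfEqOn
  convert h2 using 1
  · exact funext fun x => (hg x).symm
  · funext x
    change v (Sum.inr x) = f₁ (g x)
    rw [← hv, hg]

theorem exists_upper_bound (hK : IsUniversalClass K) [Nonempty M₁]
    (c : Set (PartialAmalgam K f₁ f₂)) (hc : IsChain Le c) (hne : c.Nonempty) :
    ∃ y, ∀ x ∈ c, Le x y := by
  -- Partial amalgams live one universe too high to index the gluing, so the chain is indexed by the
  -- submodels `A`, with one chosen amalgam for each.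
  let ι : Type u := {A : L.Substructure M₂ // ∃ x ∈ c, x.A = A}
  choose x hx hxA using fun A : ι => A.2
  have hcomp : ∀ y ∈ c, ∀ z ∈ c, y.A ≤ z.A → QfEqOn L (dom M₁ y.A) y.v z.v := by
    intro y hy z hz h
    by_cases hyz : y = z
    · subst hyz; exact QfEq.refl _
    rcases hc hy hz hyz with h' | h'
    · exact h'.2
    · exact (QfEqOn.mono h'.2 (dom_mono h)).symm
  have htot : ∀ A B : ι, A ≤ B ∨ B ≤ A := by
    intro A B
    by_cases hAB : x A = x B
    · left
      change A.1 ≤ B.1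
      rw [← hxA A, ← hxA B, hAB]
    rcases hc (hx A) (hx B) hAB with h | h
    · left
      change A.1 ≤ B.1
      rw [← hxA A, ← hxA B]; exact h.1
    · right
      change B.1 ≤ A.1
      rw [← hxA A, ← hxA B]; exact h.1
  have hdir : IsDirectedOrder ι := ⟨fun A B => by
    rcases htot A B with h | h
    exacts [⟨B, h, le_rfl⟩, ⟨A, le_rfl, h⟩]⟩
  have hι : Nonempty ι := ⟨⟨_, hne.choose, hne.choose_spec, rfl⟩⟩
  obtain ⟨N, _, w, hN, hw⟩ := hK.exists_glue (fun A : ι => dom M₁ A.1)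
    (fun A B h => dom_mono h) (fun A => ⟨Sum.inl (Classical.arbitrary _), Or.inl ⟨_, rfl⟩⟩)
    (fun A => (x A).N) (fun A => (x A).v) (fun A => (x A).mem) (fun A B h => by
      have h1 := hcomp _ (hx A) _ (hx B) (by rw [hxA, hxA]; exact h)
      rwa [hxA] at h1)
  have hdirS : Directed (· ≤ ·) fun A : ι => A.1 := fun A B => by
    obtain ⟨C, h1, h2⟩ := exists_ge_ge A B
    exact ⟨C, h1, h2⟩
  have hinl : ∀ A : ι, QfEq L ((x A).v ∘ Sum.inl) (w ∘ Sum.inl) := fun A =>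
    (hw A).comp fun m : M₁ => (⟨Sum.inl m, Or.inl ⟨m, rfl⟩⟩ : dom M₁ A.1)
  have hinr : ∀ A : ι, QfEqOn L (A.1 : Set M₂) ((x A).v ∘ Sum.inr) (w ∘ Sum.inr) := fun A =>
    (hw A).comp fun m : (A.1 : Set M₂) => (⟨Sum.inr m, Or.inr ⟨m, m.2, rfl⟩⟩ : dom M₁ A.1)
  have A₀ : ι := Classical.arbitrary ι
  have hle₀ : f₂.toHom.range ≤ A₀.1 := (x A₀).le.trans (hxA A₀).le
  refine ⟨⟨⨆ A : ι, A.1, N, hN, w, (x A₀).left.trans (hinl A₀), ?_, fun m => ?_,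
    hle₀.trans (le_iSup (fun A : ι => A.1) A₀)⟩, fun y hy => ⟨?_, ?_⟩⟩
  · refine QfEqOn.of_finite fun t ht htA => ?_
    have hex : ∃ A : ι, t ⊆ A.1 := by
      have hmem : ∀ y ∈ t, ∃ A : ι, y ∈ A.1 := fun y hy =>
        (Substructure.mem_iSup_of_directed hdirS).1 (htA hy)
      induction t, ht using Set.Finite.induction_on with
      | empty => exact ⟨A₀, Set.empty_subset _⟩
      | @insert a t _ _ ih =>
        obtain ⟨A, hA⟩ := ih ((Set.subset_insert _ _).trans htA)
          fun y hy => hmem y (Set.mem_insert_of_mem _ hy)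
        obtain ⟨B, hB⟩ := hmem a (Set.mem_insert _ _)
        obtain ⟨C, h1, h2⟩ := hdirS A B
        exact ⟨C, Set.insert_subset (h2 hB) (hA.trans h1)⟩
    obtain ⟨A, hA⟩ := hex
    have h1 := (x A).right
    rw [hxA] at h1
    exact ⟨A.1, hA, QfEqOn.trans h1 (hinr A)⟩
  · exact ((hw A₀).apply_eq_iff (Or.inl ⟨_, rfl⟩) (Or.inr ⟨_, hle₀ ⟨m, rfl⟩, rfl⟩)).1
      ((x A₀).glue m)
  · exact le_iSup (fun A : ι => A.1) ⟨y.A, y, hy, rfl⟩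
  · exact (hcomp y hy _ (hx ⟨y.A, y, hy, rfl⟩) (hxA ⟨y.A, y, hy, rfl⟩).ge).trans
      (hw ⟨y.A, y, hy, rfl⟩)

end PartialAmalgam

section Above

variable {lam : Cardinal.{u}} {s : GoodFrame K {lam}}

/-- The type of `b` over `x.A` is extended along the embedding of `x.A` into `x.N`. A realization in
an extension of `x.N` is where the model generated by `x.A` and `b` gets mapped. -/
theorem GoodFrame.exists_larger_partialAmalgam (hK : IsUniversalClass K) (hlam : LS L ≤ lam)
    (hs : s.TypeFull) {M₀ M₁ M₂ : Type u} [L.Structure M₀] [L.Structure M₁] [L.Structure M₂]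
    {f₁ : M₀ ↪[L] M₁} {f₂ : M₀ ↪[L] M₂} (hM₀ : lam ≤ #M₀) (hM₂ : K M₂)
    (x : PartialAmalgam K f₁ f₂) (b : M₂) :
    ∃ y : PartialAmalgam K f₁ f₂, x.Le y ∧ b ∈ y.A := by
  classical
  have h1 : QfEq L (id : x.A → x.A) fun m : x.A => x.v (Sum.inr m) :=
    (QfEq.embedding x.A.subtype id).trans x.right
  obtain ⟨j, hj⟩ := h1.exists_embedding_of_id
  obtain ⟨N', _, hN', e', b', h⟩ := s.exists_extension hK hlam hs
    (hM₀.trans ((card_range_embedding f₂).symm.le.trans (card_mono x.le))) x.mem hM₂ j x.A.subtype b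
  have hS : insert b (x.A : Set M₂) = Set.range (pt x.A.subtype b) := by
    ext m
    constructor
    · rintro (rfl | hm)
      exacts [⟨none, rfl⟩, ⟨some ⟨m, hm⟩, rfl⟩]
    · rintro ⟨_ | m, rfl⟩
      exacts [Or.inl rfl, Or.inr m.2]
  obtain ⟨g, hg⟩ := h.exists_embedding_closure hS
  let A' := Substructure.closure L (insert b (x.A : Set M₂))
  have hAA' : x.A ≤ A' := fun m hm => Substructure.subset_closure (Set.mem_insert_of_mem _ hm)
  let v : M₁ ⊕ M₂ → N' := Sum.elim (fun m => e' (x.v (Sum.inl m))) fun m =>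
    if hm : m ∈ A' then g ⟨m, hm⟩ else e' (x.v (Sum.inr m))
  have hv : ∀ m ∈ x.A, v (Sum.inr m) = e' (x.v (Sum.inr m)) := by
    intro m hm
    have h2 := hg (some ⟨m, hm⟩) (hAA' hm)
    simp only [v, Sum.elim_inr, dif_pos (hAA' hm)]
    refine h2.trans ?_
    exact congrArg e' (hj ⟨m, hm⟩)
  refine ⟨⟨A', N', hN', v, x.left.trans (QfEq.embedding e' _), ?_, fun m => ?_, x.le.trans hAA'⟩,
    ⟨hAA', ?_⟩, Substructure.subset_closure (Set.mem_insert _ _)⟩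
  · have h2 : (fun m : (A' : Set M₂) => (v ∘ Sum.inr) m) = g := by
      funext m
      exact dif_pos m.2
    unfold QfEqOn
    rw [h2]
    exact (QfEq.embedding A'.subtype id).symm.trans (QfEq.embedding g id)
  · rw [hv (f₂ m) (x.le ⟨m, rfl⟩), ← x.glue]
    rfl
  · have h2 : (fun m : PartialAmalgam.dom M₁ x.A => v m) =
        e' ∘ fun m : PartialAmalgam.dom M₁ x.A => x.v m := by
      funext m
      obtain ⟨_, ⟨m, rfl⟩ | ⟨m, hm, rfl⟩⟩ := m
      exacts [rfl, hv m hm]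
    unfold QfEqOn
    rw [h2]
    exact QfEq.embedding e' _

theorem GoodFrame.amalgamation_above (s : GoodFrame K {lam}) (hK : IsUniversalClass K)
    (hlam : LS L ≤ lam) (hs : s.TypeFull) : Amalgamation (K.restr (Set.Ici lam)) := by
  intro M₀ M₁ M₂ _ _ _ hM₀ hM₁ hM₂ f₁ f₂
  have : Nonempty M₁ := by
    rw [← mk_ne_zero_iff]
    exact ((aleph0_pos.trans_le aleph0_le_LS).trans_le (hlam.trans hM₁.2)).ne'
  have := PartialAmalgam.nonempty (f₁ := f₁) (f₂ := f₂) hM₁.1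
  obtain ⟨x, hx⟩ := exists_maximal_of_nonempty_chains_bounded
    (fun c hc hne => PartialAmalgam.exists_upper_bound (f₁ := f₁) (f₂ := f₂) hK c hc hne)
    (fun h h' => PartialAmalgam.Le.trans h h')
  -- A maximal partial amalgam absorbs every point of `M₂`.
  have htop : ∀ m, m ∈ x.A := fun b => by
    obtain ⟨y, hy, hb⟩ := s.exists_larger_partialAmalgam hK hlam hs hM₀.2 hM₂.1 x b
    exact (hx y hy).1 hb
  obtain ⟨g₁, hg₁⟩ := x.left.exists_embedding_of_id
  have hr : QfEq L (id : M₂ → M₂) (x.v ∘ Sum.inr) :=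
    x.right.comp fun m : M₂ => (⟨m, htop m⟩ : (x.A : Set M₂))
  obtain ⟨g₂, hg₂⟩ := hr.exists_embedding_of_id
  refine ⟨x.N, inferInstance, g₁, g₂, ⟨x.mem, hM₁.2.trans (mk_le_of_injective g₁.injective)⟩, ?_⟩
  ext m
  exact (hg₁ _).trans ((x.glue m).trans (hg₂ _).symm)

/-! ### Joint embedding, no maximal models and stability above `lam`. -/

theorem exists_small_submodel (hK : IsUniversalClass K) (hlam : LS L ≤ lam) {M : Type u}
    [L.Structure M] (hM : K.restr (Set.Ici lam) M) :
    ∃ A : L.Substructure M, K.restr {lam} A := by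
  obtain ⟨A, -, hA⟩ := exists_substructure_card hlam (M := (⊤ : L.Substructure M))
    (by rw [mk_congr Substructure.topEquiv.toEquiv]; exact hM.2)
  exact ⟨A, restr_substructure hK hlam hM.1 (by simp) hA⟩

/-- Submodels of size `lam` embed jointly by hypothesis; two amalgamations over them then absorb
`M₁` and `M₂`. -/
theorem GoodFrame.jointEmbedding_above (s : GoodFrame K {lam}) (hK : IsUniversalClass K)
    (hlam : LS L ≤ lam) (hs : s.TypeFull) : JointEmbedding (K.restr (Set.Ici lam)) := by
  intro M₁ M₂ _ _ hM₁ hM₂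
  obtain ⟨A₁, hA₁⟩ := exists_small_submodel hK hlam hM₁
  obtain ⟨A₂, hA₂⟩ := exists_small_submodel hK hlam hM₂
  have hup : ∀ {M : Type u} [L.Structure M], K.restr {lam} M → K.restr (Set.Ici lam) M :=
    fun h => ⟨h.1, h.2.ge⟩
  have hAP := s.amalgamation_above hK hlam hs
  obtain ⟨N₀, _, hN₀, ⟨g₁⟩, ⟨g₂⟩⟩ := s.jointEmbedding A₁ A₂ hA₁ hA₂
  obtain ⟨N₁, _, k₁, l₁, hN₁, -⟩ := hAP _ _ _ (hup hA₁) hM₁ (hup hN₀) A₁.subtype g₁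
  obtain ⟨N₂, _, k₂, l₂, hN₂, -⟩ := hAP _ _ _ (hup hA₂) hM₂ hN₁ A₂.subtype (l₁.comp g₂)
  exact ⟨N₂, inferInstance, hN₂, ⟨l₂.comp k₁⟩, ⟨k₂⟩⟩

/-- A nonalgebraic type over a small submodel has a nonforking extension to `M`, whose realization
lies outside `M`. -/
theorem GoodFrame.noMaximalModels_above (s : GoodFrame K {lam}) (hK : IsUniversalClass K)
    (hlam : LS L ≤ lam) (hs : s.TypeFull) : NoMaximalModels (K.restr (Set.Ici lam)) := by
  intro M _ hM
  obtain ⟨A, hA⟩ := exists_small_submodel hK hlam hM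
  obtain ⟨N, _, f, hN, hf⟩ := s.noMaximalModels A hA
  obtain ⟨a, ha⟩ : ∃ a, a ∉ Set.range f := by
    by_contra! h
    exact hf h
  obtain ⟨N', _, hN', e', a', h, -⟩ :=
    s.exists_indepOver_extension hK hlam hs hM.1 hN.1 hA.2 f a ha
  exact ⟨N', inferInstance, e', ⟨hN', hM.2.trans (mk_le_of_injective e'.injective)⟩,
    fun hsurj => h.notMem hK hlam (hsurj a')⟩

/-- Stability. -/
theorem GoodFrame.card_nonalgebraic_le (s : GoodFrame K {lam}) (hK : IsUniversalClass K)
    (hlam : LS L ≤ lam) (hs : s.TypeFull) (M : Type u) [L.Structure M] (hM : K M)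
    (hMc : lam ≤ #M) : #(nonalgebraic K M) ≤ Cardinal.lift.{u + 1} #M := by
  induction hμ : #M using WellFoundedLT.induction generalizing M with
  | ind μ ih =>
    subst hμ
    rcases hMc.eq_or_lt with heq | hlt
    · rw [← hs M ⟨hM, heq.symm⟩]
      exact s.stability M ⟨hM, heq.symm⟩
    obtain ⟨A₀, hA₀⟩ := exists_small_submodel hK hlam ⟨hM, hMc⟩
    have hA₀c : #A₀ = lam := hA₀.2
    have hinf : ℵ₀ ≤ #M := aleph0_le_LS.trans (hlam.trans hMc)
    obtain ⟨rank, -, hsurj, hrlt, hcard⟩ := exists_rank M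
    have hlim := isSuccLimit_ord hinf
    -- `A₀` is put into every stage so that all `S i` have size at least `lam`, as the induction
    -- hypothesis requires.
    let T : Ordinal.{u} → Set M := fun i => (A₀ : Set M) ∪ {x | rank x < i}
    have hTmono : Monotone T := fun i j hij =>
      Set.union_subset_union_right _ fun x (hx : rank x < i) => lt_of_lt_of_le hx hij
    let S : Ordinal.{u} → L.Substructure M := fun i => Substructure.closure L (T i)
    have hSmono : Monotone S := fun i j hij => Substructure.closure_mono (hTmono hij)
    have hSA : ∀ i, A₀ ≤ S i := fun i x hx => Substructure.subset_closure (Or.inl hx)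
    have hSge : ∀ i, lam ≤ #(S i) := fun i => hA₀c.symm.le.trans (card_mono (hSA i))
    have hSlt : ∀ i < (#M).ord, #(S i) < #M := by
      intro i hi
      refine lt_of_le_of_lt (card_closure_le (κ := max lam #{x | rank x < i})
        (hlam.trans (le_max_left _ _)) ?_) (max_lt hlt (hcard i hi))
      refine (mk_union_le _ _).trans (add_le_of_le ?_ ?_ (le_max_right _ _))
      · exact (aleph0_le_LS.trans hlam).trans (le_max_left _ _)
      · exact hA₀c.le.trans (le_max_left _ _)
    have hSlim : ∀ j, Order.IsSuccLimit j → ∀ x ∈ S j, ∃ i < j, x ∈ S i := by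
      intro j hj x hx
      have hT : T j = ⋃ i : Set.Iio j, T i := by
        ext y
        simp only [Set.mem_iUnion]
        constructor
        · rintro (hy | hy)
          · exact ⟨⟨0, hj.bot_lt⟩, Or.inl hy⟩
          · exact ⟨⟨Order.succ (rank y), hj.succ_lt hy⟩, Or.inr (Order.lt_succ (rank y))⟩
        · rintro ⟨i, hi⟩
          exact hTmono (le_of_lt i.2) hi
      change x ∈ Substructure.closure L (T j) at hx
      rw [hT, Substructure.closure_iUnion] at hx
      have : Nonempty (Set.Iio j) := ⟨⟨0, hj.bot_lt⟩⟩
      rw [Substructure.mem_iSup_of_directed] at hx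
      · obtain ⟨i, hi⟩ := hx
        exact ⟨i, i.2, hi⟩
      · exact Monotone.directed_le fun i j hij => hSmono hij
    have hStop : ∀ x, ∃ i < (#M).ord, x ∈ S i := fun x =>
      ⟨Order.succ (rank x), hlim.succ_lt (hrlt x),
        Substructure.subset_closure (Or.inr (Order.lt_succ (rank x)))⟩
    have hSK : ∀ i, K (S i) := fun i =>
      (restr_substructure hK hlam hM (F := Set.Ici lam) le_rfl (hSge i)).1
    -- Each type does not fork over a small submodel of some stage. The stage is coded by the point
    -- `x` of that rank, so that there are `#M` possible codes.
    have hex : ∀ p : nonalgebraic K M, ∃ (x : M) (N : Type u) (_ : L.Structure N) (hN : K N)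
        (e : M ↪[L] N) (a : N) (A : L.Substructure M), gtp hN e a = p ∧ a ∉ Set.range e ∧
          A ≤ S (rank x) ∧ s.IndepOver (A.map e.toHom) e.toHom.range a := by
      rintro ⟨p, N, _, hN, e, a, ha, rfl⟩
      obtain ⟨i, hi, A, hA, h⟩ := s.exists_indepOver_of_chain hK hlam hs hN
        (M := e.toHom.range) (a := a) (by rintro ⟨x, hx⟩; exact ha ⟨x, hx⟩) hlim
        (fun i => (S i).map e.toHom) (fun i _ => by rw [card_map_embedding]; exact hSge i)
        (fun i j hij _ => Substructure.monotone_map (hSmono hij))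
        (fun j _ hj => by
          rintro _ ⟨x, hx, rfl⟩
          obtain ⟨i, hi, hxi⟩ := hSlim j hj x hx
          exact ⟨i, hi, x, hxi, rfl⟩)
        (fun i _ => Hom.map_le_range)
        (by
          rintro _ ⟨x, rfl⟩
          obtain ⟨i, hi, hxi⟩ := hStop x
          exact ⟨i, hi, x, hxi, rfl⟩)
      obtain ⟨x, rfl⟩ := hsurj i hi
      have hA' := map_comap_of_le_range e h.le
      rw [← hA'] at hA h
      exact ⟨x, N, inferInstance, hN, e, a, _, rfl, ha, (map_embedding_le_iff e).1 hA, h⟩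
    choose x hx using hex
    have hna : ∀ p : nonalgebraic K M,
        p.1.restrict (S (rank (x p))).subtype ∈ nonalgebraic K (S (rank (x p))) := by
      intro p
      obtain ⟨N, _, hN, e, a, A, hp, ha, -, -⟩ := hx p
      rw [← hp, restrict_gtp, gtp_mem_nonalgebraic_iff hK]
      rintro ⟨y, rfl⟩
      exact ha ⟨y, rfl⟩
    -- A type is recovered from its stage and its restriction to that stage, by uniqueness; two
    -- types may use different small bases inside the stage.
    let F : nonalgebraic K M → Σ y : M, nonalgebraic K (S (rank y)) := fun p => ⟨x p, _, hna p⟩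
    have hF : Function.Injective F := by
      intro p q hpq
      have h1 : x p = x q := congrArg Sigma.fst hpq
      have h2 : p.1.restrict (S (rank (x p))).subtype = q.1.restrict (S (rank (x p))).subtype := by
        have h3 : ∀ y (hy : y = x q) (h : p.1.restrict (S (rank y)).subtype ∈
            nonalgebraic K (S (rank y))), (⟨y, _, h⟩ : Σ y : M, nonalgebraic K (S (rank y))) = F q →
            p.1.restrict (S (rank y)).subtype = q.1.restrict (S (rank y)).subtype := by
          rintro _ rfl h h4
          exact congrArg Subtype.val (eq_of_heq (Sigma.mk.inj h4).2)
        exact h3 _ h1 (hna p) hpq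
      obtain ⟨N, _, hN, e, a, A, hp, -, hA, h⟩ := hx p
      obtain ⟨N', _, hN', e', a', A', hq, -, hA', h'⟩ := hx q
      rw [← h1] at hA'
      apply Subtype.ext
      rw [← hp, ← hq, restrict_gtp, restrict_gtp, gtp_eq_iff hK] at h2
      rw [← hp, ← hq, gtp_eq_iff hK]
      exact s.indepOver_unique hK hlam hN hN' hA hA' h h' h2
    calc #(nonalgebraic K M) ≤ #(Σ y : M, nonalgebraic K (S (rank y))) := mk_le_of_injective hF
      _ = Cardinal.sum fun y : M => #(nonalgebraic K (S (rank y))) := mk_sigma _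
      _ ≤ Cardinal.sum fun _ : M => Cardinal.lift.{u + 1} #M := sum_le_sum _ _ fun y =>
          (ih _ (hSlt _ (hrlt y)) _ (hSK _) (hSge _) rfl).trans
            (Cardinal.lift_le.2 (hSlt _ (hrlt y)).le)
      _ = Cardinal.lift.{u + 1} #M := by
          rw [sum_const, Cardinal.lift_lift, ← Cardinal.lift_mul, mul_eq_self hinf]

end Above

/-! ### The frame on all models of size at least `lam` -/

section Frame

variable {lam : Cardinal.{u}}

theorem restr_map_iff (hK : IsUniversalClass K) {F : Set Cardinal.{u}} {N N' : Type u}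
    [L.Structure N] [L.Structure N'] (g : N ↪[L] N') (M : L.Substructure N) :
    K.restr F (M.map g.toHom) ↔ K.restr F M := by
  unfold StrClass.restr
  rw [hK.map_iff, card_map_embedding]

/-- Nonforking for models of size at least `lam`. -/
def GoodFrame.NfAbove (s : GoodFrame K {lam}) {N : Type u} [L.Structure N]
    (M₀ M₁ : L.Substructure N) (a : N) : Prop :=
  M₀ ≤ M₁ ∧ K.restr (Set.Ici lam) M₀ ∧ K.restr (Set.Ici lam) M₁ ∧ K.restr (Set.Ici lam) N ∧
    ∃ A ≤ M₀, s.IndepOver A M₁ a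

theorem GoodFrame.nfAbove_map_iff (s : GoodFrame K {lam}) (hK : IsUniversalClass K)
    (hlam : LS L ≤ lam) {N N' : Type u} [L.Structure N] [L.Structure N'] (g : N ↪[L] N')
    (hN : K.restr (Set.Ici lam) N) (hN' : K.restr (Set.Ici lam) N') {M₀ M₁ : L.Substructure N}
    {a : N} : s.NfAbove (M₀.map g.toHom) (M₁.map g.toHom) (g a) ↔ s.NfAbove M₀ M₁ a := by
  unfold GoodFrame.NfAbove
  rw [map_embedding_le_iff, restr_map_iff hK, restr_map_iff hK]
  refine and_congr_right fun _ => and_congr_right fun _ => and_congr_right fun _ =>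
    and_congr (iff_of_true hN' hN) ⟨?_, ?_⟩
  · rintro ⟨A, hA, h⟩
    have hA' := map_comap_of_le_range g (hA.trans Hom.map_le_range)
    rw [← hA'] at hA h
    exact ⟨_, (map_embedding_le_iff g).1 hA, (PreFrame.IndepOver.map_iff hK hlam g).1 h⟩
  · rintro ⟨A, hA, h⟩
    exact ⟨_, (map_embedding_le_iff g).2 hA, (PreFrame.IndepOver.map_iff hK hlam g).2 h⟩

/-- The pre-frame on the models of size at least `lam` induced by a frame in `lam`. -/
def GoodFrame.preFrameAbove (s : GoodFrame K {lam}) (hK : IsUniversalClass K)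
    (hlam : LS L ≤ lam) : PreFrame K (Set.Ici lam) where
  bs M _ := {p | K.restr (Set.Ici lam) M ∧ p ∈ nonalgebraic K M}
  nf := s.NfAbove
  exists_model := by
    obtain ⟨M, _, hM, hMl⟩ := s.exists_model
    refine ⟨M, inferInstance, hM, ?_⟩
    rw [Set.mem_singleton_iff.1 hMl.1]
    exact isLeast_Ici
  bs_dom _ _ _ hp := hp
  nf_dom h := ⟨h.1, h.2.1, h.2.2.1, h.2.2.2.1⟩
  nf_iso f _ _ _ h hN' :=
    (s.nfAbove_map_iff hK hlam f.toEmbedding h.2.2.2.1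
      ⟨hN', h.2.2.2.1.2.trans_eq (mk_congr f.toEquiv)⟩).2 h
  bs_iso := by
    rintro N N' _ _ hN hN' f M a ⟨hM, ha⟩
    refine ⟨(restr_map_iff hK f.toEmbedding M).2 hM, ?_⟩
    rw [gtp_mem_nonalgebraic_iff hK] at ha ⊢
    rintro ⟨⟨_, y, hy, rfl⟩, hya⟩
    exact ha ⟨⟨y, hy⟩, f.injective hya⟩
  nf_mono := by
    rintro N _ M₀ M₀' M₁' M₁ a ⟨-, -, -, hN, A, hA, h⟩ h0 h01 h1 hM₀' hM₁'
    exact ⟨h01, hM₀', hM₁', hN, A, hA.trans h0,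
      h.mono hK hlam le_rfl ((hA.trans h0).trans h01) h1 h.card⟩
  nf_ambient N' _ _ _ hN hN' := (s.nfAbove_map_iff hK hlam N'.subtype hN' hN).symm
  nf_basic := by
    rintro N _ hN M a ⟨-, hM, -, -, A, -, h⟩
    refine ⟨hM, (gtp_mem_nonalgebraic_iff hK).2 ?_⟩
    rintro ⟨y, rfl⟩
    exact h.notMem hK hlam y.2

/-- Again any representative can be tested, and the small base can be named inside `M` rather than
inside the ambient model. -/
theorem GoodFrame.doesNotFork_above_iff (s : GoodFrame K {lam}) (hK : IsUniversalClass K)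
    (hlam : LS L ≤ lam) {M N : Type u} [L.Structure M] [L.Structure N] (hN : K N) {e : M ↪[L] N}
    {a : N} {M₀ : L.Substructure M} :
    (s.preFrameAbove hK hlam).DoesNotFork (gtp hN e a) M₀ ↔
      lam ≤ #M₀ ∧ ∃ A ≤ M₀, s.IndepOver (A.map e.toHom) e.toHom.range a := by
  constructor
  · rintro ⟨N', _, hN', e', a', h, -, hM₀, -, -, A, hA, hAi⟩
    have hA' := map_comap_of_le_range e' hAi.le
    rw [← hA'] at hA hAi
    refine ⟨((restr_map_iff hK e' M₀).1 hM₀).2, _, (map_embedding_le_iff e').1 hA, ?_⟩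
    exact transfer_of_qfEq hK (fun A B a => s.IndepOver A B a)
      (fun g A B a _ _ => (PreFrame.IndepOver.map_iff hK hlam g).symm) hN' hN
      ((gtp_eq_iff hK).1 h) hAi
  · rintro ⟨hM₀, A, hA, h⟩
    have hM₀' : lam ≤ #(M₀.map e.toHom) := by rwa [card_map_embedding]
    have hr : lam ≤ #e.toHom.range := hM₀'.trans (card_mono Hom.map_le_range)
    exact ⟨N, inferInstance, hN, e, a, rfl, Hom.map_le_range,
      restr_substructure hK hlam hN le_rfl hM₀', restr_substructure hK hlam hN le_rfl hr,
      ⟨hN, hr.trans (mk_subtype_le _)⟩, _, (map_embedding_le_iff e).2 hA, h⟩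

theorem IsResolution.exists_indepOver {s : GoodFrame K {lam}} (hK : IsUniversalClass K)
    (hlam : LS L ≤ lam) (hs : s.TypeFull) {N P : Type u} [L.Structure N] [L.Structure P]
    (hP : K P) {δ : Ordinal.{u}} {M : Ordinal.{u} → L.Substructure N}
    (hM : IsResolution (K.restr (Set.Ici lam)) N δ M) (e : N ↪[L] P) {a : P}
    (ha : a ∉ Set.range e) :
    ∃ i < δ, ∃ A ≤ M i, s.IndepOver (A.map e.toHom) e.toHom.range a := by
  obtain ⟨i, hi, A, hA, h⟩ := s.exists_indepOver_of_chain hK hlam hs hP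
    (M := e.toHom.range) (a := a) (by rintro ⟨x, hx⟩; exact ha ⟨x, hx⟩) hM.isLimit
    (fun i => (M i).map e.toHom) (fun i hi => by rw [card_map_embedding]; exact (hM.mem i hi).2)
    (fun i j hij hj => Substructure.monotone_map (hM.mono i j hij hj))
    (fun j hj hl => by
      rintro _ ⟨x, hx, rfl⟩
      rw [hM.continuous j hj hl] at hx
      simp only [Set.mem_iUnion] at hx
      obtain ⟨i, hi, hxi⟩ := hx
      exact ⟨i, hi, x, hxi, rfl⟩)
    (fun i _ => Hom.map_le_range)
    (by
      rintro _ ⟨x, rfl⟩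
      have hx : x ∈ ⋃ i ∈ Set.Iio δ, (M i : Set N) := hM.union ▸ Set.mem_univ x
      simp only [Set.mem_iUnion] at hx
      obtain ⟨i, hi, hxi⟩ := hx
      exact ⟨i, hi, x, hxi, rfl⟩)
  have hA' := map_comap_of_le_range e h.le
  rw [← hA'] at hA h
  exact ⟨i, hi, _, (map_embedding_le_iff e).1 hA, h⟩

/-- A type-full good frame in `lam` on a universal class extends to all larger cardinals. -/
def GoodFrame.above (s : GoodFrame K {lam}) (hK : IsUniversalClass K) (hlam : LS L ≤ lam)
    (hs : s.TypeFull) : GoodFrame K (Set.Ici lam) where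
  toPreFrame := s.preFrameAbove hK hlam
  amalgamation := s.amalgamation_above hK hlam hs
  jointEmbedding := s.jointEmbedding_above hK hlam hs
  noMaximalModels := s.noMaximalModels_above hK hlam hs
  stability M _ hM := (mk_le_mk_of_subset fun _ hp => hp.2).trans
    (s.card_nonalgebraic_le hK hlam hs M hM.1 hM.2)
  density N _ M hN _ hM hne := by
    obtain ⟨a, ha⟩ : ∃ a, a ∉ M := by
      by_contra! h
      exact hne (eq_top_iff.2 fun x _ => h x)
    refine ⟨a, ha, hM, (gtp_mem_nonalgebraic_iff hK).2 ?_⟩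
    rintro ⟨y, rfl⟩
    exact ha y.2
  existence := by
    rintro N _ M hN _ ⟨hM, P, _, hP, i, a, ha, rfl⟩
    obtain ⟨N', _, hN', e', a', A, h, hq⟩ :=
      s.exists_nonforking_extension hK hlam hs hM.2 hN.1 hP M.subtype i a ha
    refine ⟨gtp hN' e' a', ⟨hN, (gtp_mem_nonalgebraic_iff hK).2 fun ⟨x, hx⟩ =>
      h.notMem hK hlam ⟨x, hx⟩⟩, ?_, ?_⟩
    · rw [restrict_gtp, gtp_eq_iff hK]
      exact hq.symm
    · rw [s.doesNotFork_above_iff hK hlam hN']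
      refine ⟨hM.2, A.map M.subtype.toHom, ?_, by rwa [map_map_embedding]⟩
      rintro _ ⟨x, -, rfl⟩
      exact x.2
  uniqueness := by
    intro N _ M p q hp hq hpq
    obtain ⟨P, _, hP, e, a, rfl⟩ := exists_eq_gtp p
    obtain ⟨P', _, hP', e', a', rfl⟩ := exists_eq_gtp q
    obtain ⟨-, A, hA, h⟩ := (s.doesNotFork_above_iff hK hlam hP).1 hp
    obtain ⟨-, A', hA', h'⟩ := (s.doesNotFork_above_iff hK hlam hP').1 hq
    rw [restrict_gtp, restrict_gtp, gtp_eq_iff hK] at hpq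
    rw [gtp_eq_iff hK]
    exact s.indepOver_unique hK hlam hP hP' hA hA' h h' hpq
  symmetry := by
    rintro N _ hN M₀ M₂ a₁ a₂ ⟨hM, hM₀, hM₂, hN', A, hA, h⟩ ha₂ ⟨-, hb⟩
    rw [gtp_mem_nonalgebraic_iff hK] at hb
    obtain ⟨A', hA', h'⟩ := s.indepOver_symm hK hlam hs hN hM hA h ha₂
      fun h => hb ⟨⟨a₂, h⟩, rfl⟩
    have hle : M₀ ≤ Substructure.closure L (insert a₁ (M₀ : Set N)) := fun x hx =>
      Substructure.subset_closure (Set.mem_insert_of_mem _ hx)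
    -- No extension of `N` is needed: the required model is generated by `a₁` and `M₀`.
    refine ⟨N, inferInstance, Embedding.refl L N, Substructure.closure L (insert a₁ (M₀ : Set N)),
      Substructure.subset_closure (Set.mem_insert _ _), ?_⟩
    rw [Embedding.refl_toHom, Substructure.map_id]
    exact ⟨hle, hM₀, restr_substructure hK hlam hN le_rfl
      (hM₀.2.trans (card_mono hle)), hN', A', hA', h'⟩
  localCharacter := by
    rintro N _ δ M - hM _ ⟨-, P, _, hP, e, a, ha, rfl⟩
    obtain ⟨i, hi, A, hA, h⟩ := hM.exists_indepOver hK hlam hs hP e ha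
    exact ⟨i, hi, (s.doesNotFork_above_iff hK hlam hP).2 ⟨(hM.mem i hi).2, A, hA, h⟩⟩
  continuity := by
    intro N _ δ M hN hM p hp
    obtain ⟨P, _, hP, e, a, rfl⟩ := exists_eq_gtp p
    have hi : ∀ i < δ, ∃ A ≤ (M 0).comap (M i).subtype.toHom,
        s.IndepOver (A.map (e.comp (M i).subtype).toHom) (e.comp (M i).subtype).toHom.range a :=
      fun i hi => ((s.doesNotFork_above_iff hK hlam hP).1 (hp i hi)).2
    have ha : a ∉ Set.range e := by
      rintro ⟨x, rfl⟩
      have hx : x ∈ ⋃ i ∈ Set.Iio δ, (M i : Set N) := hM.union ▸ Set.mem_univ x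
      simp only [Set.mem_iUnion] at hx
      obtain ⟨i, hiδ, hxi⟩ := hx
      obtain ⟨A, -, h⟩ := hi i hiδ
      exact h.notMem hK hlam ⟨⟨x, hxi⟩, rfl⟩
    refine ⟨⟨hN, (gtp_mem_nonalgebraic_iff hK).2 ha⟩, ?_⟩
    -- Local character puts a small base for the whole type inside some `M i`; there the type does
    -- not fork over `M 0` by hypothesis, and transitivity concludes.
    obtain ⟨i, hiδ, A, hA, h⟩ := hM.exists_indepOver hK hlam hs hP e ha
    obtain ⟨A', hA', h'⟩ := hi i hiδ
    refine (s.doesNotFork_above_iff hK hlam hP).2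
      ⟨(hM.mem 0 hM.isLimit.bot_lt).2, A'.map (M i).subtype.toHom,
        Substructure.map_le_iff_le_comap.2 hA', ?_⟩
    rw [map_map_embedding]
    have hr : (e.comp (M i).subtype).toHom.range = (M i).map e.toHom := by
      rw [← map_range, Substructure.range_subtype]
    rw [hr] at h'
    exact s.indepOver_trans hK hlam hP h ((map_embedding_le_iff e).2 hA) Hom.map_le_range h'
  transitivity := by
    intro N _ M₁ M₀ p hp hp'
    obtain ⟨P, _, hP, e, a, rfl⟩ := exists_eq_gtp p
    obtain ⟨-, A, hA, h⟩ := (s.doesNotFork_above_iff hK hlam hP).1 hp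
    obtain ⟨hM₀, A', hA', h'⟩ := (s.doesNotFork_above_iff hK hlam hP).1 hp'
    refine (s.doesNotFork_above_iff hK hlam hP).2 ⟨by rwa [card_map_embedding],
      A'.map M₁.subtype.toHom, Substructure.monotone_map hA', ?_⟩
    rw [map_map_embedding]
    have hr : (e.comp M₁.subtype).toHom.range = M₁.map e.toHom := by
      rw [← map_range, Substructure.range_subtype]
    rw [hr] at h'
    exact s.indepOver_trans hK hlam hP h ((map_embedding_le_iff e).2 hA) Hom.map_le_range h'

end Frame

end UnivFrame

theorem mainTheorem2 {L : FirstOrder.Language.{u, u}} (K : UnivFrame.StrClass L)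
    (hK : UnivFrame.IsUniversalClass K) (lam : Cardinal.{u}) (hlam : UnivFrame.LS L ≤ lam)
    (h : UnivFrame.HasGoodFrame K {lam}) : UnivFrame.HasGoodFrame K (Set.Ici lam) := by
  obtain ⟨s, hs⟩ := h
  refine ⟨s.above hK hlam hs, fun M _ hM => ?_⟩
  ext p
  exact ⟨fun hp => hp.2, fun hp => ⟨hM, hp⟩⟩
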